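/- Let $n_p,n_{in}\ge 1$ and $T>0$. An LPV system is a tuple $\Sigma=(A_i,B_i,C_i)_{i=0}^{n_p}$ with $A_i\in\mathbb R^{n_x\times n_x}$, $B_i\in\mathbb R^{n_x\times n_{in}}$, $C_i\in\mathbb R^{1\times n_x}$ (the state dimension $n_x$ may depend on $\Sigma$). For $p\in\mathbb R^{n_p}$ put $A(p)=A_0+\sum_{i=1}^{n_p}p_iA_i$, and define $B(p)$, $C(p)$ in the same way. For piecewise continuous $u:[0,T]\to\mathbb R^{n_{in}}$ and $p:[0,T]\to[-1,1]^{n_p}$, let $x$ be the absolutely continuous solution of $\dot x=A(p)x+B(p)u$ (a.e. on $[0,T]$), $x(0)=0$, and let $y_\Sigma(u,p)(t)=C(p(t))x(t)$. For $\lambda\ge 0$ define the $\lambda$-weighted $H_2$ norm of $\Sigma$ by $$\|\Sigma\|_{\lambda,H_2}^2=\sum_{i_q,i_r=0}^{n_p}\ \sum_{k=0}^\infty\ \sum_{I\in\{1,\dots,n_p\}^k}\ \int_{0\le\tau_1\le\cdots\le\tau_{k+1}}\|w^\lambda_{i_q,i_r,I}(\tau)\|_2^2\,d\tau,$$ where,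 for $I=(i_1,\dots,i_k)$, $$w^\lambda_{i_q,i_r,I}(\tau)=C_{i_q}e^{A_0(\tau_{k+1}-\tau_k)}A_{i_k}e^{A_0(\tau_k-\tau_{k-1})}\cdots A_{i_1}e^{A_0\tau_1}B_{i_r}e^{\frac{\lambda}{2}\tau_{k+1}}.$$ Let $\mathcal E$ be a set of LPV systems, let $\mathcal U,\mathcal P,\mathcal Y$ be sets of piecewise continuous functions on $[0,T]$ with values in $\mathbb R^{n_{in}}$, $[-1,1]^{n_p}$ and $\mathbb R$, respectively, and let $\ell:\mathbb R\times\mathbb R\to[0,\infty)$. Let $\mathcal D$ be a probability measure on a $\sigma$-algebra of $\mathcal U\times\mathcal P\times\mathcal Y$ for which $(u,p,y)\mapsto\ell(y_\Sigma(u,p)(T),y(T))$ is measurable for every $\Sigma\in\mathcal E$. Define the true risk $\mathcal L(\Sigma)=\mathbb E_{(u,p,y)\sim\mathcal D}[\ell(y_\Sigma(u,p)(T),y(T))]$ and, for a data set $S=((u_i,p_i,y_i))_{i=1}^N$, $N\ge1$, the empirical risk $\mathcal L_N^S(\Sigma)=\frac1N\sum_{i=1}^N\ell(y_\Sigma(u_i,p_i)(T),y_i(T))$.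 Assume: 1. (Stability) $\lambda\ge n_p$ is such that for every $\Sigma\in\mathcal E$ there is $Q\succ0$ with $A_0^TQ+QA_0+\sum_{i=1}^{n_p}A_i^TQA_i+\sum_{i=0}^{n_p}C_i^TC_i\prec-\lambda Q$. 2. (Bounded $H_2$ norm) $\|\Sigma\|_{\lambda,H_2}\le c_{\mathcal E}$ for all $\Sigma\in\mathcal E$, with this same $\lambda$ and some finite $c_{\mathcal E}\ge 0$. 3. (Bounded signals) $\|u\|_{L^2([0,T],\mathbb R^{n_{in}})}\le L_u$ for all $u\in\mathcal U$, and $|y(T)|\le c_y$ for all $y\in\mathcal Y$. 4. (Lipschitz loss) $|\ell(y_1,y_1')-\ell(y_2,y_2')|\le K_\ell(|y_1-y_2|+|y_1'-y_2'|)$ for all $y_1,y_1',y_2,y_2'\in\mathbb R$, and $\ell(y,y)=0$ for all $y\in\mathbb R$. Put $c=2K_\ell\max\{L_u(n_p+1)c_{\mathcal E},\,c_y\}$ and $R(\delta)=c\left(2+5\sqrt{2\log(8/\delta)}\right)$. Let $\Sigma_\star\in\mathcal E$ be a minimizer of $\mathcal L$ over $\mathcal E$. Then for every $\delta\in(0,1)$,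 with probability at least $1-\delta$ over $S\sim\mathcal D^N$, every minimizer $\hat\Sigma=\hat\Sigma(S)\in\mathcal E$ of $\mathcal L_N^S$ over $\mathcal E$ satisfies $$\mathcal L(\hat\Sigma)\le\mathcal L(\Sigma_\star)+\frac{R(\delta)}{\sqrt N}.$$ Here "with probability at least $1-\delta$" means that the claim holds for all $S$ in some measurable set of $\mathcal D^N$-measure at least $1-\delta$. -/

import Mathlib

open MeasureTheory Filter Topology

noncomputable section

/-- A scalar-output LPV state-space representation with affine dependence on the `np` scheduling
variables and with `nin` inputs. The state dimension `nx` is part of the system. The tuple is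
`(A_i, B_i, C_i)`, `i = 0, …, np`. -/
structure LPVSystem (np nin : ℕ) where
  nx : ℕ
  A : Fin (np + 1) → Matrix (Fin nx) (Fin nx) ℝ
  B : Fin (np + 1) → Matrix (Fin nx) (Fin nin) ℝ
  C : Fin (np + 1) → Matrix (Fin 1) (Fin nx) ℝ

/-- `M_0 + ∑_{i=1}^{np} p_i M_i`. -/
def affineComb {np m n : ℕ} (M : Fin (np + 1) → Matrix (Fin m) (Fin n) ℝ) (p : Fin np → ℝ) :
    Matrix (Fin m) (Fin n) ℝ :=
  M 0 + ∑ i : Fin np, p i • M i.succ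

/-- Piecewise continuity on `[0, T]`: finitely many discontinuities, and finite one-sided limits
everywhere. Only the values on `[0, T]` matter. -/
def PiecewiseContinuous {E : Type*} [TopologicalSpace E] (T : ℝ) (f : ℝ → E) : Prop :=
  (∃ F : Finset ℝ, ∀ t ∈ Set.Icc 0 T, t ∉ F → ContinuousWithinAt f (Set.Icc 0 T) t) ∧
  (∀ t ∈ Set.Ico 0 T, ∃ l : E, Tendsto f (𝓝[>] t) (𝓝 l)) ∧
  (∀ t ∈ Set.Ioc 0 T, ∃ l : E, Tendsto f (𝓝[<] t) (𝓝 l))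

namespace LPVSystem

variable {np nin : ℕ}

/-- `x` is the state trajectory on `[0, T]` for the input `u` and the scheduling signal `p`:
it is absolutely continuous, starts at zero, and `x' = A(p) x + B(p) u` almost everywhere. -/
structure IsStateTrajectory (S : LPVSystem np nin) (T : ℝ)
    (u : ℝ → EuclideanSpace ℝ (Fin nin)) (p : ℝ → Fin np → ℝ)
    (x : ℝ → Fin S.nx → ℝ) : Prop where
  absolutelyContinuous : AbsolutelyContinuousOnInterval x 0 T
  init : x 0 = 0
  ode : ∀ᵐ t : ℝ, t ∈ Set.Icc 0 T →
    HasDerivAt x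
      ((affineComb S.A (p t)).mulVec (x t) + (affineComb S.B (p t)).mulVec (u t).ofLp) t

open Classical in
/-- The output `y_Σ(u, p)(t) = C(p(t)) x(t)`, `t ∈ [0, T]`, where `x` is the state trajectory on
`[0, T]` (it exists and is unique on `[0, T]` for piecewise continuous `u` and `p`). -/
def output (S : LPVSystem np nin) (T : ℝ)
    (u : ℝ → EuclideanSpace ℝ (Fin nin)) (p : ℝ → Fin np → ℝ) (t : ℝ) : ℝ :=
  if h : ∃ x, S.IsStateTrajectory T u p x then
    (affineComb S.C (p t)).mulVec (h.choose t) 0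
  else 0

/-- `e^{A_0 (τ_{k+1} - τ_k)} A_{i_k} e^{A_0 (τ_k - τ_{k-1})} ⋯ A_{i_1} e^{A_0 τ_1}`, where the entry
`τ j` of the Lean tuple is `τ_{j+1}` and the entry `I j` is `i_{j+1}`. -/
def kernelProd (S : LPVSystem np nin) :
    (k : ℕ) → (Fin k → Fin np) → (Fin (k + 1) → ℝ) → Matrix (Fin S.nx) (Fin S.nx) ℝ
  | 0, _, τ => NormedSpace.exp (τ 0 • S.A 0)
  | k + 1, I, τ =>
      NormedSpace.exp ((τ (Fin.last (k + 1)) - τ (Fin.last k).castSucc) • S.A 0)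
        * S.A (I (Fin.last k)).succ
        * kernelProd S k (fun j => I j.castSucc) (fun j => τ j.castSucc)

/-- The `λ`-weighted LPV Volterra kernel `w^λ_{i_q, i_r, I}(τ)`, a row vector. -/
def kernel (S : LPVSystem np nin) (lam : ℝ) (iq ir : Fin (np + 1)) {k : ℕ}
    (I : Fin k → Fin np) (τ : Fin (k + 1) → ℝ) : Matrix (Fin 1) (Fin nin) ℝ :=
  Real.exp (lam / 2 * τ (Fin.last k)) • (S.C iq * S.kernelProd k I τ * S.B ir)

/-- The simplex `{0 ≤ τ_1 ≤ ⋯ ≤ τ_{k+1}}`. -/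
def infSimplex (k : ℕ) : Set (Fin (k + 1) → ℝ) :=
  {τ | 0 ≤ τ 0 ∧ Monotone τ}

/-- The `λ`-weighted `H_2` norm, with value `∞` when the defining series diverges. -/
def h2Norm (S : LPVSystem np nin) (lam : ℝ) : ENNReal :=
  (∑ iq : Fin (np + 1), ∑ ir : Fin (np + 1), ∑' k : ℕ, ∑ I : Fin k → Fin np,
    ∫⁻ τ in infSimplex k,
      ENNReal.ofReal (∑ j : Fin nin, (S.kernel lam iq ir I τ 0 j) ^ 2)) ^ (1 / 2 : ℝ)

/-- There is `Q ≻ 0` such that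
`A_0ᵀ Q + Q A_0 + ∑_{i=1}^{np} A_iᵀ Q A_i + ∑_{i=0}^{np} C_iᵀ C_i ≺ -λ Q`. -/
def IsQuadStable (S : LPVSystem np nin) (lam : ℝ) : Prop :=
  ∃ Q : Matrix (Fin S.nx) (Fin S.nx) ℝ, Q.PosDef ∧
    (-(lam • Q) -
      ((S.A 0).transpose * Q + Q * S.A 0
        + ∑ i : Fin np, (S.A i.succ).transpose * Q * S.A i.succ
        + ∑ i : Fin (np + 1), (S.C i).transpose * S.C i)).PosDef

end LPVSystem

/-- A data point `(u, p, y) ∈ Us × Ps × Ys`. It is a structure of its own, so that it carries no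
σ-algebra but the one given in the theorem. -/
structure DataPoint {np nin : ℕ} (Us : Set (ℝ → EuclideanSpace ℝ (Fin nin)))
    (Ps : Set (ℝ → Fin np → ℝ)) (Ys : Set (ℝ → ℝ)) where
  u : Us
  p : Ps
  y : Ys

section Risk

variable {np nin : ℕ} {Us : Set (ℝ → EuclideanSpace ℝ (Fin nin))}
  {Ps : Set (ℝ → Fin np → ℝ)} {Ys : Set (ℝ → ℝ)}

/-- `ℓ(y_Σ(u, p)(T), y(T))` at the data point `(u, p, y)`. -/
def pointLoss (T : ℝ) (loss : ℝ → ℝ → ℝ) (S : LPVSystem np nin) (z : DataPoint Us Ps Ys) : ℝ :=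
  loss (S.output T z.u.1 z.p.1 T) (z.y.1 T)

/-- The true risk at time `T`. -/
def trueRisk [MeasurableSpace (DataPoint Us Ps Ys)] (D : Measure (DataPoint Us Ps Ys))
    (T : ℝ) (loss : ℝ → ℝ → ℝ) (S : LPVSystem np nin) : ℝ :=
  ∫ z, pointLoss T loss S z ∂D

/-- The empirical risk at time `T` with respect to the data set `s`. -/
def empRisk {N : ℕ} (s : Fin N → DataPoint Us Ps Ys)
    (T : ℝ) (loss : ℝ → ℝ → ℝ) (S : LPVSystem np nin) : ℝ :=
  (1 / (N : ℝ)) * ∑ i : Fin N, pointLoss T loss S (s i)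

end Risk

/-- `c = 2 K max {L_u (np + 1) c_E, c_y}`. -/
def riskConst (np : ℕ) (K Lu cE cy : ℝ) : ℝ :=
  2 * K * max (Lu * ((np : ℝ) + 1) * cE) cy

/-- `R(δ) = c (2 + 5 √(2 log (8 / δ)))`. -/
def riskRadius (c δ : ℝ) : ℝ :=
  c * (2 + 5 * Real.sqrt (2 * Real.log (8 / δ)))

end

/-! The proof turns the class of systems into a ball of linear functionals on one Hilbert space and
then applies a dimension-free bound for empirical risk minimization.

Expanding the state by Picard iteration around `A_0` gives the Volterra series, and hence the output
at `T` is a sum over `(k, i_q, i_r, I)` of integrals over simplices. Each integrand is a kernel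
depending only on the system, paired with a feature depending only on the signals. Splitting the
weight as `e^{λτ/2} e^{-λτ/2}` between the two gives `y_Σ(u,p)(T) = ⟪w_Σ, φ(u,p)⟫` in the `L²` space
of the disjoint union of all simplices (`LPVSystem.output_eq_integral_inner`). There `‖w_Σ‖` is
exactly the weighted `H_2` norm (`LPVSystem.eLpNorm_kernelFun`). Since a simplex has slice volume
`s^k / k!` and there are `np^k` words of length `k`, `‖φ‖²` is at most `(np + 1)²` times the
integral of `e^{np s} e^{-λ s} ‖u(T - s)‖²`; the condition `λ ≥ np` therefore yields `‖φ‖ ≤ (np + 1)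
L_u` (`eLpNorm_featureFun_le`).

For Lipschitz images of functionals with `‖w‖ ≤ a` on features with `‖φ‖ ≤ b`, the expected supremum
of the summed deviations is at most `2 K a b √N` (`integral_iSup_deviation_le`, which merges
symmetrization and contraction into one induction). A bounded-differences inequality
(`hasSubgaussianMGF_of_bounded_differences`) adds the fluctuation `2 c √(2 log(1/δ)) √N`.
`exists_measurableSet_risk_le` combines the two, and the resulting constant is below `R(δ)`. -/

section

open ProbabilityTheory NNReal

/-! ### Bounded differences on product spaces -/

section ProductMeasure

theorem finCons_eq_piFinSuccAbove_symm {Z : Type*} [MeasurableSpace Z] (n : ℕ) :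
    (fun q : Z × (Fin n → Z) => (Fin.cons q.1 q.2 : Fin (n + 1) → Z)) =
      (MeasurableEquiv.piFinSuccAbove (fun _ : Fin (n + 1) => Z) 0).symm := by
  funext q
  simp [MeasurableEquiv.piFinSuccAbove_symm_apply, Fin.insertNthEquiv]

theorem measurableEmbedding_finCons {Z : Type*} [MeasurableSpace Z] (n : ℕ) :
    MeasurableEmbedding (fun q : Z × (Fin n → Z) => (Fin.cons q.1 q.2 : Fin (n + 1) → Z)) := by
  rw [finCons_eq_piFinSuccAbove_symm]
  exact (MeasurableEquiv.piFinSuccAbove (fun _ : Fin (n + 1) => Z) 0).symm.measurableEmbedding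

variable {Z : Type*} [MeasurableSpace Z] (D : Measure Z) [IsProbabilityMeasure D]

/-- Splitting off the first coordinate preserves the product measure. -/
theorem measurePreserving_finCons (n : ℕ) :
    MeasurePreserving (fun q : Z × (Fin n → Z) => (Fin.cons q.1 q.2 : Fin (n + 1) → Z))
      (D.prod (Measure.pi fun _ => D)) (Measure.pi fun _ => D) := by
  rw [finCons_eq_piFinSuccAbove_symm]
  exact (measurePreserving_piFinSuccAbove (fun _ : Fin (n + 1) => D) 0).symm

theorem integral_pi_succ {n : ℕ} {F : (Fin (n + 1) → Z) → ℝ}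
    (hF : Integrable F (Measure.pi fun _ => D)) :
    ∫ s, F s ∂(Measure.pi fun _ => D) =
      ∫ s, ∫ z, F (Fin.cons z s) ∂D ∂(Measure.pi fun _ => D) := by
  rw [← (measurePreserving_finCons D n).integral_comp (measurableEmbedding_finCons n)]
  exact integral_prod_symm _ ((measurePreserving_finCons D n).integrable_comp_of_integrable hF)

theorem integrable_of_measurable_of_abs_le {Ω : Type*} [MeasurableSpace Ω] {μ : Measure Ω}
    [IsFiniteMeasure μ] {f : Ω → ℝ} (hf : Measurable f) {B : ℝ} (hB : ∀ x, |f x| ≤ B) :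
    Integrable f μ :=
  Integrable.of_bound hf.aestronglyMeasurable B (ae_of_all _ fun x => by simpa using hB x)

theorem abs_integral_le_of_abs_le {Ω : Type*} [MeasurableSpace Ω] {μ : Measure Ω}
    [IsProbabilityMeasure μ] {f : Ω → ℝ} {B : ℝ} (hB : ∀ x, |f x| ≤ B) :
    |∫ x, f x ∂μ| ≤ B := by
  have h := norm_integral_le_of_norm_le_const (μ := μ) (f := f) (C := B)
    (ae_of_all _ fun x => by rw [Real.norm_eq_abs]; exact hB x)
  rwa [Real.norm_eq_abs, probReal_univ, mul_one] at h

/-- McDiarmid's inequality (with a suboptimal constant), as a bound for the moment generating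
function of a function with bounded differences. -/
theorem hasSubgaussianMGF_of_bounded_differences (c : ℝ≥0) :
    ∀ (n : ℕ) (f : (Fin n → Z) → ℝ), Measurable f → ∀ B : ℝ, (∀ s, |f s| ≤ B) →
      (∀ s i z, |f (Function.update s i z) - f s| ≤ c) →
      HasSubgaussianMGF (fun s => f s - ∫ s, f s ∂(Measure.pi fun _ => D)) (n * c ^ 2)
        (Measure.pi fun _ => D) := by
  intro n
  induction n with
  | zero =>
    intro f _ B _ _
    have h : ∀ s, f s - ∫ s, f s ∂(Measure.pi fun _ : Fin 0 => D) = 0 := by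
      intro s
      have : ∀ s', f s' = f s := fun s' => by rw [Subsingleton.elim s' s]
      simp [this]
    simp only [h]
    simp
  | succ n ih =>
    intro f hf B hB hd
    obtain ⟨z₀⟩ : Nonempty Z := nonempty_of_isProbabilityMeasure D
    have hfm : Measurable (fun q : Z × (Fin n → Z) => f (Fin.cons q.1 q.2)) :=
      hf.comp (measurableEmbedding_finCons n).measurable
    have hfm1 : ∀ s : Fin n → Z, Measurable (fun z => f (Fin.cons z s)) := fun s =>
      hfm.comp (measurable_id.prodMk measurable_const)
    -- Averaging over the first coordinate preserves the mean and the bounded differences, so the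
    -- induction hypothesis controls `g`. The remainder `f - g` is centred for each frozen tail.
    set g : (Fin n → Z) → ℝ := fun s => ∫ z, f (Fin.cons z s) ∂D with hg
    have hgm : Measurable g :=
      (StronglyMeasurable.integral_prod_left' (μ := D) hfm.stronglyMeasurable).measurable
    have hgB : ∀ s, |g s| ≤ B := fun s => abs_integral_le_of_abs_le fun z => hB _
    have hgd : ∀ s i z, |g (Function.update s i z) - g s| ≤ c := by
      intro s i z
      simp only [hg]
      rw [← integral_sub (integrable_of_measurable_of_abs_le (hfm1 _) fun _ => hB _)
        (integrable_of_measurable_of_abs_le (hfm1 _) fun _ => hB _)]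
      refine abs_integral_le_of_abs_le fun z' => ?_
      rw [Fin.cons_update]
      exact hd _ _ _
    have hint : Integrable f (Measure.pi fun _ : Fin (n + 1) => D) :=
      integrable_of_measurable_of_abs_le hf hB
    have hmean : ∫ s, f s ∂(Measure.pi fun _ => D) = ∫ s, g s ∂(Measure.pi fun _ => D) :=
      integral_pi_succ D hint
    have ihg := ih g hgm B hgB hgd
    set E := ∫ s, g s ∂(Measure.pi fun _ : Fin n => D) with hE
    rw [hmean]
    have hEB : |E| ≤ B := abs_integral_le_of_abs_le hgB
    have hexp : ∀ t : ℝ, Integrable (fun s => Real.exp (t * (f s - E)))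
        (Measure.pi fun _ : Fin (n + 1) => D) := by
      intro t
      refine integrable_of_measurable_of_abs_le (B := Real.exp (|t| * (B + B))) (by fun_prop) ?_
      intro s
      rw [abs_of_pos (Real.exp_pos _), Real.exp_le_exp]
      calc t * (f s - E) ≤ |t * (f s - E)| := le_abs_self _
        _ = |t| * |f s - E| := abs_mul _ _
        _ ≤ |t| * (B + B) := by
          gcongr
          exact (abs_sub _ _).trans (add_le_add (hB s) hEB)
    refine ⟨hexp, fun t => ?_⟩
    have hcond : ∀ s : Fin n → Z, ∫ z, Real.exp (t * (f (Fin.cons z s) - E)) ∂D ≤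
        Real.exp (c ^ 2 * t ^ 2 / 2) * Real.exp (t * (g s - E)) := by
      intro s
      -- For a frozen tail, all values lie within `c` of the value at `z₀`, an interval of length
      -- `2c`. Hoeffding's lemma gives the parameter `(2c / 2)² = c²`; using the oscillation `c`
      -- instead would save a factor 4.
      have hH : HasSubgaussianMGF (fun z => f (Fin.cons z s) - g s)
          ((‖(f (Fin.cons z₀ s) + c) - (f (Fin.cons z₀ s) - c)‖₊ / 2) ^ 2) D := by
        refine hasSubgaussianMGF_of_mem_Icc (hfm1 s).aemeasurable (ae_of_all _ fun z => ?_)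
        have h := hd (Fin.cons z₀ s) 0 z
        rw [Fin.update_cons_zero, abs_le] at h
        constructor <;> linarith
      have hc : (‖(f (Fin.cons z₀ s) + (c : ℝ)) - (f (Fin.cons z₀ s) - c)‖₊ / 2 : ℝ≥0) = c := by
        ext
        push_cast
        rw [add_sub_sub_cancel, Real.norm_of_nonneg (by positivity)]
        ring
      rw [hc] at hH
      have h1 := hH.mgf_le t
      rw [mgf] at h1
      have h2 : ∀ z, Real.exp (t * (f (Fin.cons z s) - E)) =
          Real.exp (t * (f (Fin.cons z s) - g s)) * Real.exp (t * (g s - E)) := by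
        intro z
        rw [← Real.exp_add]
        ring_nf
      simp only [h2]
      rw [integral_mul_const]
      gcongr
      exact_mod_cast h1
    rw [mgf, integral_pi_succ D (hexp t)]
    calc ∫ s, ∫ z, Real.exp (t * (f (Fin.cons z s) - E)) ∂D ∂(Measure.pi fun _ : Fin n => D)
        ≤ ∫ s, Real.exp (c ^ 2 * t ^ 2 / 2) * Real.exp (t * (g s - E))
            ∂(Measure.pi fun _ : Fin n => D) := by
          refine integral_mono_of_nonneg (ae_of_all _ fun s => integral_nonneg fun z =>
            (Real.exp_pos _).le) ((ihg.integrable_exp_mul t).const_mul _) (ae_of_all _ hcond)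
      _ = Real.exp (c ^ 2 * t ^ 2 / 2) * mgf (fun s => g s - E)
            (Measure.pi fun _ : Fin n => D) t := by
          rw [integral_const_mul, mgf]
      _ ≤ Real.exp (c ^ 2 * t ^ 2 / 2) * Real.exp ((n * c ^ 2 : ℝ≥0) * t ^ 2 / 2) := by
          gcongr
          exact ihg.mgf_le t
      _ = Real.exp (((n + 1 : ℕ) * c ^ 2 : ℝ≥0) * t ^ 2 / 2) := by
          rw [← Real.exp_add]
          push_cast
          ring_nf

end ProductMeasure

end

/-! ### Expected uniform deviations over a Hilbert ball -/

section

open ProbabilityTheory NNReal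
open scoped InnerProductSpace

theorem abs_ciSup_le {ι : Type*} [Nonempty ι] {x : ι → ℝ} {B : ℝ} (h : ∀ m, |x m| ≤ B) :
    |⨆ m, x m| ≤ B := by
  have hb : BddAbove (Set.range x) := ⟨B, by rintro _ ⟨m, rfl⟩; exact (abs_le.1 (h m)).2⟩
  obtain ⟨m₀⟩ := ‹Nonempty ι›
  exact abs_le.2 ⟨(abs_le.1 (h m₀)).1.trans (le_ciSup hb m₀), ciSup_le fun m => (abs_le.1 (h m)).2⟩

theorem le_ciSup_of_abs_le {ι : Type*} {x : ι → ℝ} {B : ℝ} (h : ∀ m, |x m| ≤ B) (m : ι) :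
    x m ≤ ⨆ m, x m :=
  le_ciSup (f := x) ⟨B, by rintro _ ⟨m, rfl⟩; exact (abs_le.1 (h m)).2⟩ m

section Rademacher

variable {Z : Type*} [MeasurableSpace Z] (D : Measure Z) [IsProbabilityMeasure D]
  {H : Type*} [NormedAddCommGroup H] [InnerProductSpace ℝ H]

/-- The squared average of two numbers is at most the average of their squares, and the
parallelogram law evaluates the latter. This keeps the growth per sample additive under the root,
which produces `√n` rather than `n`. -/
theorem half_sqrt_add_half_sqrt_le (v x : H) {r : ℝ} (hr : 0 ≤ r) {M : ℝ} (hx : ‖x‖ ≤ M) :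
    (1 / 2) * (√(‖v + x‖ ^ 2 + r) + √(‖v - x‖ ^ 2 + r)) ≤ √(‖v‖ ^ 2 + (r + M ^ 2)) := by
  apply Real.le_sqrt_of_sq_le
  have h1 := Real.sq_sqrt (show 0 ≤ ‖v + x‖ ^ 2 + r by positivity)
  have h2 := Real.sq_sqrt (show 0 ≤ ‖v - x‖ ^ 2 + r by positivity)
  have h3 := parallelogram_law_with_norm ℝ v x
  have h4 : ‖x‖ ^ 2 ≤ M ^ 2 := by gcongr
  nlinarith [sq_nonneg (√(‖v + x‖ ^ 2 + r) - √(‖v - x‖ ^ 2 + r))]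

/-- A bound for the expected uniform deviation of the empirical means of a class of functions that
are Lipschitz images of linear functionals on a Hilbert space. -/
theorem integral_iSup_deviation_le {w : ℕ → H} {φ : Z → H} {f : ℕ → Z → ℝ} {a b K c : ℝ}
    (hw : ∀ m, ‖w m‖ ≤ a) (hφ : ∀ z, ‖φ z‖ ≤ b) (hK : 0 ≤ K)
    (hfm : ∀ m, Measurable (f m)) (hfc : ∀ m z, |f m z| ≤ c)
    (hlip : ∀ m m' z, |f m z - f m' z| ≤ K * |⟪w m, φ z⟫_ℝ - ⟪w m', φ z⟫_ℝ|) (n : ℕ) :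
    ∀ v : H, ∫ s, ⨆ m, (∑ i : Fin n, (∫ z, f m z ∂D - f m (s i)) + ⟪w m, v⟫_ℝ)
      ∂(Measure.pi fun _ => D) ≤ a * √(‖v‖ ^ 2 + n * (2 * K * b) ^ 2) := by
  have ha : 0 ≤ a := (norm_nonneg _).trans (hw 0)
  have hinner : ∀ m v, |⟪w m, v⟫_ℝ| ≤ a * ‖v‖ := fun m v =>
    (abs_real_inner_le_norm _ _).trans (by gcongr; exact hw m)
  -- The shift `v` stays general: each sample that is integrated out becomes a shift by `±x`, so the
  -- claim for `n + 1` at `v` reduces to the claim for `n` at `v ± x`.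
  induction n with
  | zero =>
    intro v
    have h : ∀ s : Fin 0 → Z, (⨆ m, (∑ i : Fin 0, (∫ z, f m z ∂D - f m (s i)) + ⟪w m, v⟫_ℝ))
        ≤ a * ‖v‖ := by
      intro s
      simp only [Finset.univ_eq_empty, Finset.sum_empty, zero_add]
      exact ciSup_le fun m => (le_abs_self _).trans (hinner m v)
    simp only [Nat.cast_zero, zero_mul, add_zero, Real.sqrt_sq (norm_nonneg v)]
    simpa using h default
  | succ n ih =>
    intro v
    set E : ℕ → ℝ := fun m => ∫ z, f m z ∂D with hE
    have hEc : ∀ m, |E m| ≤ c := fun m => abs_integral_le_of_abs_le (hfc m)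
    set G : (Fin n → Z) → ℕ → ℝ := fun s m => ∑ i : Fin n, (E m - f m (s i)) + ⟪w m, v⟫_ℝ with hG
    have hGm : ∀ m, Measurable fun s => G s m := fun m => by
      simp only [hG]
      fun_prop
    have hGB : ∀ s m, |G s m| ≤ n * (c + c) + a * ‖v‖ := by
      intro s m
      refine (abs_add_le _ _).trans (add_le_add ?_ (hinner m v))
      refine (Finset.abs_sum_le_sum_abs _ _).trans ?_
      refine (Finset.sum_le_card_nsmul _ _ (c + c) fun i _ =>
        (abs_sub _ _).trans (add_le_add (hEc m) (hfc m _))).trans_eq ?_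
      rw [Finset.card_univ, Fintype.card_fin, nsmul_eq_mul]
    set B := n * (c + c) + a * ‖v‖
    have hPB : ∀ s z m, |2 * f m z + G s m| ≤ 2 * c + B := fun s z m =>
      (abs_add_le _ _).trans (add_le_add (by rw [abs_mul, abs_two]; linarith [hfc m z]) (hGB s m))
    have hNB : ∀ s z m, |-(2 * f m z) + G s m| ≤ 2 * c + B := fun s z m =>
      (abs_add_le _ _).trans
        (add_le_add (by rw [abs_neg, abs_mul, abs_two]; linarith [hfc m z]) (hGB s m))
    -- `P` and `Q` are the two outcomes of a random sign in front of `2 f`; their average plays the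
    -- role of a Rademacher expectation.
    set P : Z × (Fin n → Z) → ℝ := fun q => ⨆ m, (2 * f m q.1 + G q.2 m) with hP
    set Q : Z × (Fin n → Z) → ℝ := fun q => ⨆ m, (-(2 * f m q.1) + G q.2 m) with hQ
    have hPm : Measurable P := Measurable.iSup fun m =>
      (((hfm m).comp measurable_fst).const_mul 2).add ((hGm m).comp measurable_snd)
    have hQm : Measurable Q := Measurable.iSup fun m =>
      (((hfm m).comp measurable_fst).const_mul 2).neg.add ((hGm m).comp measurable_snd)
    have hPb : ∀ q, |P q| ≤ 2 * c + B := fun q => abs_ciSup_le (hPB q.2 q.1)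
    have hQb : ∀ q, |Q q| ≤ 2 * c + B := fun q => abs_ciSup_le (hNB q.2 q.1)
    have hmk : ∀ s : Fin n → Z, Measurable fun z : Z => (z, s) := fun s => by fun_prop
    have hmk' : ∀ z : Z, Measurable fun s : Fin n → Z => (z, s) := fun z => by fun_prop
    have hPi : ∀ s, Integrable (fun z => P (z, s)) D := fun s =>
      integrable_of_measurable_of_abs_le (hPm.comp (hmk s)) fun z => hPb _
    have hQi : ∀ s, Integrable (fun z => Q (z, s)) D := fun s =>
      integrable_of_measurable_of_abs_le (hQm.comp (hmk s)) fun z => hQb _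
    set F : (Fin (n + 1) → Z) → ℝ :=
      fun s => ⨆ m, (∑ i : Fin (n + 1), (E m - f m (s i)) + ⟪w m, v⟫_ℝ) with hF
    have hFcons : ∀ z s, F (Fin.cons z s) = ⨆ m, (E m - f m z + G s m) := by
      intro z s
      simp only [hF, hG, Fin.sum_univ_succ, Fin.cons_zero, Fin.cons_succ, add_assoc]
    have hFBa : ∀ z s m, |E m - f m z + G s m| ≤ (c + c) + B := fun z s m =>
      (abs_add_le _ _).trans (add_le_add ((abs_sub _ _).trans (add_le_add (hEc m) (hfc m _)))
        (hGB s m))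
    have hFm : Measurable F := Measurable.iSup fun m => by fun_prop
    have hFB : ∀ s, |F s| ≤ (c + c) + B := by
      intro s
      rw [← Fin.cons_self_tail s, hFcons]
      exact abs_ciSup_le (hFBa _ _)
    have hFcm : ∀ s, Measurable fun z => F (Fin.cons z s) := fun s => by
      simp only [hFcons]
      exact Measurable.iSup fun m => by fun_prop
    have hFi : ∀ s, Integrable (fun z => F (Fin.cons z s)) D := fun s =>
      integrable_of_measurable_of_abs_le (hFcm s) (B := (c + c) + B) fun z => hFB _
    -- Symmetrization of one sample without a ghost sample: `E - f + G` is the average of `2E + G`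
    -- and `-2f + G`. The first is at most the mean of `P`, the second at most `Q`.
    have hstep : ∀ s, ∫ z, F (Fin.cons z s) ∂D ≤ ∫ z, (1 / 2) * (P (z, s) + Q (z, s)) ∂D := by
      intro s
      have h1 : ∀ m, 2 * E m + G s m ≤ ∫ z, P (z, s) ∂D := by
        intro m
        have hfi := integrable_of_measurable_of_abs_le (μ := D) (hfm m) (hfc m)
        have : 2 * E m + G s m = ∫ z, (2 * f m z + G s m) ∂D := by
          rw [integral_add (hfi.const_mul 2) (integrable_const _), integral_const_mul]
          simp [hE]
        rw [this]
        exact integral_mono ((hfi.const_mul 2).add (integrable_const _)) (hPi s) fun z =>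
          le_ciSup_of_abs_le (hPB s z) m
      have h2 : ∀ z, F (Fin.cons z s) ≤ (1 / 2) * ((∫ z, P (z, s) ∂D) + Q (z, s)) := by
        intro z
        rw [hFcons]
        refine ciSup_le fun m => ?_
        have h3 : -(2 * f m z) + G s m ≤ Q (z, s) := le_ciSup_of_abs_le (hNB s z) m
        linarith [h1 m]
      refine (integral_mono (hFi s) (((integrable_const _).add (hQi s)).const_mul _) h2).trans ?_
      rw [integral_const_mul, integral_const_mul, integral_add' (integrable_const _) (hQi s),
        integral_add (hPi s) (hQi s)]
      simp
    have hPQm : Measurable fun q => (1 / 2) * (P q + Q q) := (hPm.add hQm).const_mul _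
    have hPQi : Integrable (fun q => (1 / 2) * (P q + Q q))
        (D.prod (Measure.pi fun _ : Fin n => D)) :=
      ((integrable_of_measurable_of_abs_le hPm hPb).add
        (integrable_of_measurable_of_abs_le hQm hQb)).const_mul _
    have hFint : Integrable F (Measure.pi fun _ : Fin (n + 1) => D) :=
      integrable_of_measurable_of_abs_le hFm hFB
    have hWB : ∀ (x : H) (s : Fin n → Z) m, |∑ i : Fin n, (E m - f m (s i)) + ⟪w m, v + x⟫_ℝ| ≤
        B + a * ‖x‖ := by
      intro x s m
      rw [inner_add_right, ← add_assoc]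
      exact (abs_add_le _ _).trans (add_le_add (hGB s m) (hinner m x))
    have hWm : ∀ x : H, Measurable fun s : Fin n → Z =>
        ⨆ m, (∑ i : Fin n, (E m - f m (s i)) + ⟪w m, v + x⟫_ℝ) := fun x =>
      Measurable.iSup fun m => by fun_prop
    have hWi : ∀ x : H, Integrable (fun s : Fin n → Z =>
        ⨆ m, (∑ i : Fin n, (E m - f m (s i)) + ⟪w m, v + x⟫_ℝ)) (Measure.pi fun _ => D) :=
      fun x => integrable_of_measurable_of_abs_le (hWm x) fun s => abs_ciSup_le (hWB x s)
    -- The sample `z` is frozen here, so that `x` is a constant vector when the induction hypothesis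
    -- is applied to the remaining samples.
    have hfix : ∀ z, ∫ s, (1 / 2) * (P (z, s) + Q (z, s)) ∂(Measure.pi fun _ : Fin n => D) ≤
        a * √(‖v‖ ^ 2 + (n + 1 : ℕ) * (2 * K * b) ^ 2) := by
      intro z
      set x : H := (2 * K) • φ z with hx
      have hxM : ‖x‖ ≤ 2 * K * b := by
        rw [hx, norm_smul, Real.norm_of_nonneg (by positivity)]
        gcongr
        exact hφ z
      have hpt : ∀ s, (1 / 2) * (P (z, s) + Q (z, s)) ≤
          (1 / 2) * ((⨆ m, (∑ i : Fin n, (E m - f m (s i)) + ⟪w m, v + x⟫_ℝ)) +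
            ⨆ m, (∑ i : Fin n, (E m - f m (s i)) + ⟪w m, v + -x⟫_ℝ)) := by
        intro s
        -- Contraction: the Lipschitz bound replaces `2 (f m z - f m' z)` by `|⟪w m - w m', x⟫|`.
        -- According to the sign, `m` takes the shift `x` and `m'` the shift `-x`, or the reverse;
        -- the right-hand side is symmetric, so both cases fit.
        have key : ∀ m m', 2 * f m z + G s m + (-(2 * f m' z) + G s m') ≤
            (⨆ m, (∑ i : Fin n, (E m - f m (s i)) + ⟪w m, v + x⟫_ℝ)) +
            ⨆ m, (∑ i : Fin n, (E m - f m (s i)) + ⟪w m, v + -x⟫_ℝ) := by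
          intro m m'
          have e1 := le_ciSup_of_abs_le (hWB x s) m
          have e2 := le_ciSup_of_abs_le (hWB (-x) s) m
          have e3 := le_ciSup_of_abs_le (hWB x s) m'
          have e4 := le_ciSup_of_abs_le (hWB (-x) s) m'
          simp only [inner_add_right, inner_neg_right, hx, inner_smul_right] at e1 e2 e3 e4 ⊢
          have e5 := (le_abs_self _).trans (hlip m m' z)
          simp only [hG]
          rcases abs_cases (⟪w m, φ z⟫_ℝ - ⟪w m', φ z⟫_ℝ) with ⟨h, _⟩ | ⟨h, _⟩ <;>
            rw [h] at e5 <;> linarith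
        have h1 : ∀ m', P (z, s) ≤ (⨆ m, (∑ i : Fin n, (E m - f m (s i)) + ⟪w m, v + x⟫_ℝ)) +
            (⨆ m, (∑ i : Fin n, (E m - f m (s i)) + ⟪w m, v + -x⟫_ℝ)) -
              (-(2 * f m' z) + G s m') :=
          fun m' => ciSup_le fun m => by linarith [key m m']
        have h2 : Q (z, s) ≤ (⨆ m, (∑ i : Fin n, (E m - f m (s i)) + ⟪w m, v + x⟫_ℝ)) +
            (⨆ m, (∑ i : Fin n, (E m - f m (s i)) + ⟪w m, v + -x⟫_ℝ)) - P (z, s) :=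
          ciSup_le fun m' => by linarith [h1 m']
        linarith
      calc ∫ s, (1 / 2) * (P (z, s) + Q (z, s)) ∂(Measure.pi fun _ : Fin n => D)
          ≤ ∫ s, (1 / 2) * ((⨆ m, (∑ i : Fin n, (E m - f m (s i)) + ⟪w m, v + x⟫_ℝ)) +
            ⨆ m, (∑ i : Fin n, (E m - f m (s i)) + ⟪w m, v + -x⟫_ℝ))
            ∂(Measure.pi fun _ : Fin n => D) :=
            integral_mono (integrable_of_measurable_of_abs_le (hPQm.comp (hmk' z))
              (B := 2 * c + B) fun s => by
                have h1 := abs_le.1 (hPb (z, s))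
                have h2 := abs_le.1 (hQb (z, s))
                refine abs_le.2 ⟨?_, ?_⟩ <;> linarith)
              (((hWi x).add (hWi (-x))).const_mul _) hpt
        _ ≤ (1 / 2) * (a * √(‖v + x‖ ^ 2 + n * (2 * K * b) ^ 2) +
              a * √(‖v + -x‖ ^ 2 + n * (2 * K * b) ^ 2)) := by
            rw [integral_const_mul, integral_add (hWi x) (hWi (-x))]
            gcongr
            · exact ih (v + x)
            · exact ih (v + -x)
        _ = a * ((1 / 2) * (√(‖v + x‖ ^ 2 + n * (2 * K * b) ^ 2) +
              √(‖v - x‖ ^ 2 + n * (2 * K * b) ^ 2))) := by rw [sub_eq_add_neg]; ring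
        _ ≤ a * √(‖v‖ ^ 2 + (n * (2 * K * b) ^ 2 + (2 * K * b) ^ 2)) := by
            gcongr
            exact half_sqrt_add_half_sqrt_le v x (by positivity) hxM
        _ = a * √(‖v‖ ^ 2 + (n + 1 : ℕ) * (2 * K * b) ^ 2) := by
            push_cast
            ring_nf
    rw [integral_pi_succ D hFint]
    calc ∫ s, ∫ z, F (Fin.cons z s) ∂D ∂(Measure.pi fun _ : Fin n => D)
        ≤ ∫ s, ∫ z, (1 / 2) * (P (z, s) + Q (z, s)) ∂D ∂(Measure.pi fun _ : Fin n => D) :=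
          integral_mono ((((measurePreserving_finCons D n).integrable_comp_of_integrable
            hFint)).integral_prod_right) hPQi.integral_prod_right hstep
      _ = ∫ z, ∫ s, (1 / 2) * (P (z, s) + Q (z, s)) ∂(Measure.pi fun _ : Fin n => D) ∂D :=
          (integral_integral_swap hPQi).symm
      _ ≤ ∫ _, a * √(‖v‖ ^ 2 + (n + 1 : ℕ) * (2 * K * b) ^ 2) ∂D :=
          integral_mono hPQi.integral_prod_left (integrable_const _) hfix
      _ = a * √(‖v‖ ^ 2 + (n + 1 : ℕ) * (2 * K * b) ^ 2) := by simp

end Rademacher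

end

/-! ### Excess risk of empirical minimizers -/

section

open ProbabilityTheory NNReal
open scoped InnerProductSpace

theorem sum_update_sub_sum {Z : Type*} {n : ℕ} (h : Z → ℝ) (s : Fin n → Z) (i : Fin n) (z : Z) :
    ∑ k, h (Function.update s i z k) - ∑ k, h (s k) = h z - h (s i) := by
  rw [← Finset.sum_sub_distrib, Finset.sum_eq_single i]
  · simp
  · intro k _ hk
    simp [Function.update_of_ne hk]
  · simp

theorem abs_ciSup_sub_ciSup_le {ι : Type*} [Nonempty ι] {x y : ι → ℝ} {B c : ℝ}
    (hx : ∀ m, |x m| ≤ B) (hy : ∀ m, |y m| ≤ B) (h : ∀ m, |x m - y m| ≤ c) :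
    |(⨆ m, x m) - ⨆ m, y m| ≤ c := by
  have h1 : (⨆ m, x m) ≤ (⨆ m, y m) + c := ciSup_le fun m => by
    linarith [le_ciSup_of_abs_le hy m, (abs_le.1 (h m)).2]
  have h2 : (⨆ m, y m) ≤ (⨆ m, x m) + c := ciSup_le fun m => by
    linarith [le_ciSup_of_abs_le hx m, (abs_le.1 (h m)).1]
  exact abs_le.2 ⟨by linarith, by linarith⟩

section EmpiricalRisk

variable {Z : Type*} [MeasurableSpace Z] (D : Measure Z) [IsProbabilityMeasure D]
  {H : Type*} [NormedAddCommGroup H] [InnerProductSpace ℝ H]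

theorem integral_eval_pi {n : ℕ} {h : Z → ℝ} (hh : Measurable h) (i : Fin n) :
    ∫ s, h (s i) ∂(Measure.pi fun _ : Fin n => D) = ∫ z, h z ∂D :=
  integral_comp_eval (μ := fun _ : Fin n => D) (i := i) (f := h) hh.aestronglyMeasurable

/-- A risk bound for empirical risk minimization over a class of Lipschitz images of bounded linear
functionals on a separable Hilbert space. -/
theorem exists_measurableSet_risk_le [SecondCountableTopology H] {ι : Type*} {w : ι → H}
    {φ : Z → H} {f : ι → Z → ℝ} {a b K c : ℝ}
    (hw : ∀ i, ‖w i‖ ≤ a) (hφ : ∀ z, ‖φ z‖ ≤ b) (hK : 0 ≤ K)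
    (hfm : ∀ i, Measurable (f i)) (hf0 : ∀ i z, 0 ≤ f i z) (hfc : ∀ i z, f i z ≤ c)
    (hlip : ∀ i j z, |f i z - f j z| ≤ K * |⟪w i, φ z⟫_ℝ - ⟪w j, φ z⟫_ℝ|)
    {n : ℕ} (hn : 0 < n) {δ : ℝ} (hδ : δ ∈ Set.Ioo (0 : ℝ) 1) (iStar : ι) :
    ∃ G : Set (Fin n → Z), MeasurableSet G ∧ 1 - δ ≤ (Measure.pi fun _ : Fin n => D).real G ∧
      ∀ s ∈ G, ∀ i, ∑ k, f i (s k) ≤ ∑ k, f iStar (s k) →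
        ∫ z, f i z ∂D ≤ ∫ z, f iStar z ∂D +
          (2 * K * a * b + 2 * c * √(2 * Real.log (1 / δ))) / √n := by
  obtain ⟨z₀⟩ : Nonempty Z := nonempty_of_isProbabilityMeasure D
  have ha : 0 ≤ a := (norm_nonneg _).trans (hw iStar)
  have hb : 0 ≤ b := (norm_nonneg _).trans (hφ z₀)
  have hc0 : 0 ≤ c := (hf0 iStar z₀).trans (hfc iStar z₀)
  have hnR : (0 : ℝ) < n := by exact_mod_cast hn
  have hfabs : ∀ i z, |f i z| ≤ c := fun i z => by rw [abs_of_nonneg (hf0 i z)]; exact hfc i z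
  have hfi : ∀ i, Integrable (f i) D := fun i =>
    integrable_of_measurable_of_abs_le (hfm i) (hfabs i)
  rcases hc0.eq_or_lt with hc | hc
  -- If `c = 0`, all losses vanish. This case is separated because the tail exponent below divides
  -- by `c²`.
  · refine ⟨Set.univ, MeasurableSet.univ, by simp [hδ.1.le], fun s _ i _ => ?_⟩
    have h0 : ∀ i z, f i z = 0 := fun i z => le_antisymm (by rw [hc]; exact hfc i z) (hf0 i z)
    simp only [h0, integral_zero, ← hc, zero_add, mul_zero, zero_mul, add_zero]
    positivity
  have : Nonempty (Set.range w) := ⟨⟨w iStar, iStar, rfl⟩⟩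
  -- A countable family, dense among the `w i`, makes the supremum measurable. Continuity of the
  -- deviations in `w i` recovers the whole class later.
  choose d hd using fun m : ℕ => (TopologicalSpace.denseSeq (Set.range w) m).2
  have hdense : ∀ i, ∀ ε > 0, ∃ m, ‖w i - w (d m)‖ < ε := by
    intro i ε hε
    obtain ⟨m, hm⟩ := (TopologicalSpace.denseRange_denseSeq (Set.range w)).exists_dist_lt
      ⟨w i, i, rfl⟩ hε
    refine ⟨m, ?_⟩
    rw [hd, ← dist_eq_norm]
    exact hm
  set E : ι → ℝ := fun i => ∫ z, f i z ∂D with hE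
  have hEc : ∀ i, |E i| ≤ c := fun i => abs_integral_le_of_abs_le (hfabs i)
  set X : (Fin n → Z) → ι → ℝ := fun s i => ∑ k, (E i - f i (s k)) with hX
  have hXB : ∀ s i, |X s i| ≤ n * (c + c) := by
    intro s i
    refine (Finset.abs_sum_le_sum_abs _ _).trans ?_
    refine (Finset.sum_le_card_nsmul _ _ (c + c) fun k _ =>
      (abs_sub _ _).trans (add_le_add (hEc i) (hfabs i _))).trans_eq ?_
    rw [Finset.card_univ, Fintype.card_fin, nsmul_eq_mul]
  have hXm : ∀ i, Measurable fun s => X s i := fun i => by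
    have := hfm i
    simp only [hX]
    fun_prop
  have hXd : ∀ s k z i, |X (Function.update s k z) i - X s i| ≤ c := by
    intro s k z i
    simp only [hX]
    rw [sum_update_sub_sum (fun z => E i - f i z)]
    exact abs_le.2 ⟨by linarith [hf0 i (s k), hfc i z], by linarith [hf0 i z, hfc i (s k)]⟩
  set U : (Fin n → Z) → ℝ := fun s => ⨆ m, X s (d m) with hU
  -- Subtracting the deviation of `iStar`, which has mean zero, leaves the expectation of the
  -- supremum unchanged and lets a single concentration bound treat both risks. The price is `2c`
  -- instead of `c` in the bounded differences.
  set Ψ : (Fin n → Z) → ℝ := fun s => U s - X s iStar with hΨ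
  have hUm : Measurable U := Measurable.iSup fun m => hXm (d m)
  have hUB : ∀ s, |U s| ≤ n * (c + c) := fun s => abs_ciSup_le fun m => hXB s (d m)
  have hΨm : Measurable Ψ := hUm.sub (hXm iStar)
  have hΨB : ∀ s, |Ψ s| ≤ n * (c + c) + n * (c + c) := fun s =>
    (abs_sub _ _).trans (add_le_add (hUB s) (hXB s iStar))
  have hΨd : ∀ s k z, |Ψ (Function.update s k z) - Ψ s| ≤ (2 * c).toNNReal := by
    intro s k z
    rw [Real.coe_toNNReal _ (by positivity)]
    have h1 := abs_le.1 (hXd s k z iStar)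
    have h2 := abs_le.1 (abs_ciSup_sub_ciSup_le (fun m => hXB (Function.update s k z) (d m))
      (fun m => hXB s (d m)) (fun m => hXd s k z (d m)))
    exact abs_le.2 ⟨by simp only [hΨ, hU]; linarith, by simp only [hΨ, hU]; linarith⟩
  have hsub := hasSubgaussianMGF_of_bounded_differences D (2 * c).toNNReal n Ψ hΨm _ hΨB hΨd
  have hmeanX : ∫ s, X s iStar ∂(Measure.pi fun _ : Fin n => D) = 0 := by
    simp only [hX]
    rw [integral_finsetSum _ fun k _ => integrable_of_measurable_of_abs_le
      (by have := hfm iStar; fun_prop) (B := c + c)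
      fun s => (abs_sub _ _).trans (add_le_add (hEc iStar) (hfabs iStar _))]
    refine Finset.sum_eq_zero fun k _ => ?_
    rw [integral_eval_pi D (h := fun z => E iStar - f iStar z) (measurable_const.sub (hfm iStar)) k,
      integral_sub (integrable_const _) (hfi iStar)]
    simp [hE]
  have hmean : ∫ s, Ψ s ∂(Measure.pi fun _ : Fin n => D) ≤ 2 * K * a * b * √n := by
    simp only [hΨ]
    rw [integral_sub (integrable_of_measurable_of_abs_le hUm hUB)
      (integrable_of_measurable_of_abs_le (hXm iStar) fun s => hXB s iStar), hmeanX, sub_zero]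
    have h := integral_iSup_deviation_le D (w := fun m => w (d m)) (f := fun m => f (d m))
      (fun m => hw _) hφ hK (fun m => hfm _) (fun m => hfabs _) (fun m m' => hlip _ _) n 0
    simp only [inner_zero_right, add_zero, norm_zero, ne_eq, OfNat.ofNat_ne_zero,
      not_false_eq_true, zero_pow, zero_add] at h
    rw [Real.sqrt_mul hnR.le, Real.sqrt_sq (by positivity)] at h
    refine h.trans_eq ?_
    ring
  set L := √(2 * Real.log (1 / δ)) with hL
  have hlog : 0 ≤ Real.log (1 / δ) := Real.log_nonneg (by
    rw [le_div_iff₀ hδ.1]; linarith [hδ.2])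
  have hLsq : L ^ 2 = 2 * Real.log (1 / δ) := Real.sq_sqrt (by positivity)
  -- The parameter is `n (2c)²`, so this threshold makes the tail `exp(-ε² / (2 n (2c)²)) = exp(-L²
  -- / 2) = δ`.
  set ε := 2 * c * L * √n with hε
  have hε0 : 0 ≤ ε := by positivity
  set A := ∫ s, Ψ s ∂(Measure.pi fun _ : Fin n => D) with hA
  refine ⟨{s | ε ≤ Ψ s - A}ᶜ, (measurableSet_le measurable_const (hΨm.sub_const _)).compl, ?_, ?_⟩
  · rw [probReal_compl_eq_one_sub (measurableSet_le measurable_const (hΨm.sub_const _))]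
    have h := hsub.measure_ge_le hε0
    have hexp : Real.exp (-ε ^ 2 / (2 * ((n : ℝ≥0) * (2 * c).toNNReal ^ 2 : ℝ≥0))) = δ := by
      push_cast
      rw [Real.coe_toNNReal _ (by positivity)]
      have h2 : -ε ^ 2 / (2 * ((n : ℝ) * (2 * c) ^ 2)) = Real.log δ := by
        have h3 : ε ^ 2 = (2 * c) ^ 2 * L ^ 2 * n := by
          rw [hε, mul_pow, Real.sq_sqrt hnR.le]
          ring
        rw [h3, hLsq, one_div, Real.log_inv]
        field_simp
      rw [h2, Real.exp_log hδ.1]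
    rw [hexp] at h
    linarith
  · intro s hs i hi
    have hs' : Ψ s < A + ε := by
      simp only [Set.mem_compl_iff, Set.mem_ofPred_eq, not_le] at hs
      linarith
    have hXU : X s i ≤ U s := by
      refine le_of_forall_pos_le_add fun η hη => ?_
      -- Replacing `i` by `d m` changes the deviation by at most `2 n K b ‖w i - w (d m)‖`; the `+
      -- 1` keeps the denominator positive when `K b = 0`.
      obtain ⟨m, hm⟩ := hdense i (η / (2 * n * (K * b) + 1)) (by positivity)
      have hdiff : ∀ z, |f i z - f (d m) z| ≤ K * b * ‖w i - w (d m)‖ := by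
        intro z
        refine (hlip _ _ _).trans ?_
        rw [← inner_sub_left, mul_assoc]
        gcongr
        refine (abs_real_inner_le_norm _ _).trans ?_
        rw [mul_comm]
        gcongr
        exact hφ z
      have hEd : |E i - E (d m)| ≤ K * b * ‖w i - w (d m)‖ := by
        simp only [hE]
        rw [← integral_sub (hfi _) (hfi _)]
        exact abs_integral_le_of_abs_le hdiff
      have h1 : X s i - X s (d m) ≤ n * (2 * (K * b * ‖w i - w (d m)‖)) := by
        simp only [hX]
        rw [← Finset.sum_sub_distrib]
        refine (Finset.sum_le_card_nsmul _ _ (2 * (K * b * ‖w i - w (d m)‖)) fun k _ => ?_).trans_eq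
          (by rw [Finset.card_univ, Fintype.card_fin, nsmul_eq_mul])
        linarith [(abs_le.1 hEd).2, (abs_le.1 (hdiff (s k))).1]
      have h2 : n * (2 * (K * b * ‖w i - w (d m)‖)) ≤ η := by
        rw [lt_div_iff₀ (by positivity)] at hm
        nlinarith [norm_nonneg (w i - w (d m))]
      have h3 : X s (d m) ≤ U s := le_ciSup_of_abs_le (fun m => hXB s (d m)) m
      linarith
    have hXe : ∀ j, X s j = n * E j - ∑ k, f j (s k) := by
      intro j
      simp [hX]
    -- Since the empirical sum of `i` does not exceed that of `iStar`, `n (E i - E iStar) ≤ X s i -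
    -- X s iStar ≤ Ψ s < A + ε`.
    have hfin : n * E i ≤ n * E iStar + (2 * K * a * b * √n + 2 * c * L * √n) := by
      have e1 := hXe i
      have e2 := hXe iStar
      simp only [hΨ] at hs'
      linarith
    have hsq : (n : ℝ) = √n * √n := (Real.mul_self_sqrt hnR.le).symm
    have hsn : 0 < √(n : ℝ) := Real.sqrt_pos.2 hnR
    change E i ≤ E iStar + (2 * K * a * b + 2 * c * L) / √n
    rw [← sub_le_iff_le_add', le_div_iff₀ hsn]
    have : (E i - E iStar) * √n * √n ≤ (2 * K * a * b + 2 * c * L) * √n := by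
      rw [mul_assoc, ← hsq]
      linarith
    exact le_of_mul_le_mul_right this hsn

end EmpiricalRisk

end

/-! ### Lebesgue measure on ordered simplices -/

theorem measurableSet_infSimplex (k : ℕ) : MeasurableSet (LPVSystem.infSimplex k) := by
  refine IsClosed.measurableSet ?_
  exact (isClosed_le continuous_const (continuous_apply 0)).inter isClosed_monotone

/-- Lebesgue measure on the simplex `{0 ≤ τ_1 ≤ ⋯ ≤ τ_{k+1}}`. -/
noncomputable def simplexMeasure (k : ℕ) : Measure (Fin (k + 1) → ℝ) :=
  volume.restrict (LPVSystem.infSimplex k)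

instance (k : ℕ) : SFinite (simplexMeasure k) := by
  unfold simplexMeasure
  infer_instance

/-- Appends `τ_{k+2} = τ_{k+1} + r` to the tuple `τ`. -/
def simplexSnoc (k : ℕ) (q : (Fin (k + 1) → ℝ) × ℝ) : Fin (k + 2) → ℝ :=
  Fin.snoc q.1 (q.1 (Fin.last k) + q.2)

@[simp] theorem simplexSnoc_castSucc (k : ℕ) (q : (Fin (k + 1) → ℝ) × ℝ) (j : Fin (k + 1)) :
    simplexSnoc k q j.castSucc = q.1 j := by
  simp [simplexSnoc]

@[simp] theorem simplexSnoc_last (k : ℕ) (q : (Fin (k + 1) → ℝ) × ℝ) :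
    simplexSnoc k q (Fin.last (k + 1)) = q.1 (Fin.last k) + q.2 := by
  simp [simplexSnoc]

theorem simplexSnoc_mem_infSimplex_iff (k : ℕ) (q : (Fin (k + 1) → ℝ) × ℝ) :
    simplexSnoc k q ∈ LPVSystem.infSimplex (k + 1) ↔
      q.1 ∈ LPVSystem.infSimplex k ∧ 0 ≤ q.2 := by
  have h0 : simplexSnoc k q 0 = q.1 0 := simplexSnoc_castSucc k q 0
  simp only [LPVSystem.infSimplex, Set.mem_ofPred_eq, h0, Fin.monotone_iff_le_succ]
  rw [Fin.forall_fin_succ' (n := k)]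
  simp only [← Fin.castSucc_succ, simplexSnoc_castSucc, Fin.succ_last, simplexSnoc_last]
  constructor
  · rintro ⟨h1, h2, h3⟩
    exact ⟨⟨h1, h2⟩, by linarith⟩
  · rintro ⟨⟨h1, h2⟩, h3⟩
    exact ⟨h1, h2, by linarith⟩

/-- The shear `(τ, r) ↦ (τ, τ_last + r)` preserves Lebesgue measure, and the ordering of the longer
tuple amounts to that of the shorter one together with `0 ≤ r`. This is the Fubini step behind every
induction on the order. -/
theorem measurePreserving_simplexSnoc (k : ℕ) :
    MeasurePreserving (simplexSnoc k)
      ((simplexMeasure k).prod (volume.restrict (Set.Ici 0))) (simplexMeasure (k + 1)) := by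
  have h1 : MeasurePreserving
      (fun q : (Fin (k + 1) → ℝ) × ℝ => (q.1, q.1 (Fin.last k) + q.2))
      (volume.prod volume) (volume.prod volume) :=
    (MeasurePreserving.id volume).skew_product (g := fun (τ : Fin (k + 1) → ℝ) (r : ℝ) => τ (Fin.last k) + r)
      (by unfold Function.uncurry; fun_prop) (ae_of_all _ fun τ => map_add_left_eq_self volume _)
  have h2 := ((volume_preserving_piFinSuccAbove (fun _ : Fin (k + 2) => ℝ)
    (Fin.last (k + 1))).symm).comp (Measure.measurePreserving_swap.comp h1)
  have h3 : MeasurePreserving (simplexSnoc k)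
      ((volume : Measure (Fin (k + 1) → ℝ)).prod (volume : Measure ℝ)) volume := by
    have e : simplexSnoc k =
        (MeasurableEquiv.piFinSuccAbove (fun _ : Fin (k + 2) => ℝ) (Fin.last (k + 1))).symm ∘
          Prod.swap ∘ fun q : (Fin (k + 1) → ℝ) × ℝ => (q.1, q.1 (Fin.last k) + q.2) := by
      funext q
      simp [simplexSnoc, MeasurableEquiv.piFinSuccAbove_symm_apply, Fin.insertNthEquiv]
    rw [e]
    exact h2
  have h4 := h3.restrict_preimage (measurableSet_infSimplex (k + 1))
  have h5 : simplexSnoc k ⁻¹' LPVSystem.infSimplex (k + 1) =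
      LPVSystem.infSimplex k ×ˢ Set.Ici 0 := by
    ext q
    exact simplexSnoc_mem_infSimplex_iff k q
  rw [h5, ← Measure.prod_restrict] at h4
  exact h4

theorem measurePreserving_simplexZero :
    MeasurePreserving (fun (r : ℝ) (_ : Fin 1) => r) (volume.restrict (Set.Ici 0))
      (simplexMeasure 0) := by
  have h := (volume_preserving_funUnique (Fin 1) ℝ).symm
  have h4 := h.restrict_preimage (measurableSet_infSimplex 0)
  have h5 : (MeasurableEquiv.funUnique (Fin 1) ℝ).symm ⁻¹' LPVSystem.infSimplex 0 =
      Set.Ici 0 := by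
    ext q
    constructor
    · exact fun h => h.1
    · exact fun h => ⟨h, fun _ _ _ => le_rfl⟩
  rw [h5] at h4
  exact h4

/-- The last coordinate has density `s^k / k!`, the volume of the ordered tuples below `s`.
Appending a gap convolves this density with the indicator of `[0, ∞)`, which raises `k` by one. -/
theorem lintegral_simplexMeasure_last (k : ℕ) : ∀ g : ℝ → ENNReal, Measurable g →
    ∫⁻ τ, g (τ (Fin.last k)) ∂simplexMeasure k =
      ∫⁻ s in Set.Ici 0, g s * ENNReal.ofReal (s ^ k / k.factorial) := by
  induction k with
  | zero =>
    intro g hg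
    rw [← measurePreserving_simplexZero.lintegral_comp (f := fun τ => g (τ (Fin.last 0)))
      (by fun_prop)]
    simp
  | succ k ih =>
    intro g hg
    rw [← (measurePreserving_simplexSnoc k).lintegral_comp
      (f := fun τ => g (τ (Fin.last (k + 1)))) (by fun_prop),
      lintegral_prod _ (by
        simp only [simplexSnoc_last]
        fun_prop)]
    simp only [simplexSnoc_last]
    have hm : Measurable fun s => ∫⁻ r in Set.Ici (0 : ℝ), g (s + r) :=
      Measurable.lintegral_prod_right' (f := fun q : ℝ × ℝ => g (q.1 + q.2)) (by fun_prop)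
    rw [ih _ hm]
    -- With the domains written as factors, Tonelli applies on the whole line, and `J s * J (x - s)`
    -- is the indicator of `0 ≤ s ≤ x`.
    set J : ℝ → ENNReal := (Set.Ici (0 : ℝ)).indicator 1 with hJ
    have hJm : Measurable J := measurable_one.indicator measurableSet_Ici
    have hind : ∀ h : ℝ → ENNReal, ∫⁻ s in Set.Ici (0 : ℝ), h s = ∫⁻ s, J s * h s := by
      intro h
      rw [← lintegral_indicator measurableSet_Ici]
      congr 1 with s
      by_cases hs : s ∈ Set.Ici (0 : ℝ) <;> simp [hJ, hs]
    have hshift : ∀ s, ∫⁻ r in Set.Ici (0 : ℝ), g (s + r) = ∫⁻ x, J (x - s) * g x := by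
      intro s
      rw [hind, ← lintegral_add_left_eq_self (fun x => J (x - s) * g x) s]
      simp
    have hker : ∀ x, ∫⁻ s, J s * J (x - s) * ENNReal.ofReal (s ^ k / k.factorial) =
        J x * ENNReal.ofReal (x ^ (k + 1) / (k + 1).factorial) := by
      intro x
      have hJJ : ∀ s, J s * J (x - s) * ENNReal.ofReal (s ^ k / k.factorial) =
          (Set.Icc 0 x).indicator (fun s => ENNReal.ofReal (s ^ k / k.factorial)) s := by
        intro s
        by_cases h1 : 0 ≤ s <;> by_cases h2 : s ≤ x <;> simp [hJ, h1, h2, Set.indicator]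
      simp only [hJJ]
      rw [lintegral_indicator measurableSet_Icc]
      rcases lt_or_ge x 0 with hx | hx
      · simp [hJ, hx]
      · have hc : Continuous fun s : ℝ => s ^ k / (k.factorial : ℝ) := by fun_prop
        rw [← ofReal_integral_eq_lintegral_ofReal (hc.integrableOn_Icc)
          ((ae_restrict_iff' measurableSet_Icc).2 (ae_of_all _ fun s hs => by
            have := hs.1
            positivity)), integral_Icc_eq_integral_Ioc, ← intervalIntegral.integral_of_le hx,
          intervalIntegral.integral_div, integral_pow]
        simp only [hJ, Set.mem_Ici, hx, Set.indicator_of_mem, Pi.one_apply, one_mul]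
        congr 1
        rw [Nat.factorial_succ]
        push_cast
        field_simp
        simp
    simp only [hshift]
    rw [hind, hind]
    calc ∫⁻ s, J s * ((∫⁻ x, J (x - s) * g x) * ENNReal.ofReal (s ^ k / k.factorial))
        = ∫⁻ s, ∫⁻ x, g x * (J s * J (x - s) * ENNReal.ofReal (s ^ k / k.factorial)) := by
          refine lintegral_congr fun s => ?_
          rw [mul_comm (∫⁻ x, J (x - s) * g x), ← mul_assoc, ← lintegral_const_mul _ (by fun_prop)]
          refine lintegral_congr fun x => ?_
          ring
      _ = ∫⁻ x, ∫⁻ s, g x * (J s * J (x - s) * ENNReal.ofReal (s ^ k / k.factorial)) :=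
          lintegral_lintegral_swap (by
            refine Measurable.aemeasurable ?_
            unfold Function.uncurry
            fun_prop)
      _ = ∫⁻ x, J x * (g x * ENNReal.ofReal (x ^ (k + 1) / (k + 1).factorial)) := by
          refine lintegral_congr fun x => ?_
          rw [lintegral_const_mul _ (by fun_prop), hker]
          ring

/-! ### Linear integral and differential equations -/

section

open scoped Matrix Matrix.Norms.Operator

section IteratedIntegrals

variable {E : Type*} [NormedAddCommGroup E] [NormedSpace ℝ E]

theorem integral_mul_pow_div_factorial (V m t : ℝ) (k : ℕ) :
    ∫ s in (0 : ℝ)..t, m * (V * (m * s) ^ k / k.factorial) =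
      V * (m * t) ^ (k + 1) / (k + 1).factorial := by
  have h : ∀ s : ℝ, m * (V * (m * s) ^ k / k.factorial) =
      (V * m ^ (k + 1) / k.factorial) * s ^ k := fun s => by
    rw [mul_pow, pow_succ]; ring
  simp only [h]
  rw [intervalIntegral.integral_const_mul, integral_pow, Nat.factorial_succ]
  push_cast
  field_simp
  simp only [ne_eq, Nat.add_eq_zero_iff, one_ne_zero, and_false, not_false_eq_true, zero_pow,
    sub_zero, mul_pow]
  ring

/-- The factorial decay of iterated integrals. -/
theorem norm_le_of_eq_iterated_integral {T V m : ℝ} (hm : 0 ≤ m) {v h : ℕ → ℝ → E}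
    (h0 : ∀ t ∈ Set.Icc 0 T, ‖v 0 t‖ ≤ V)
    (hv : ∀ k, ∀ t ∈ Set.Icc 0 T, v (k + 1) t = ∫ s in (0 : ℝ)..t, h k s)
    (hh : ∀ k, ∀ s ∈ Set.Icc 0 T, ‖h k s‖ ≤ m * ‖v k s‖) (k : ℕ) :
    ∀ t ∈ Set.Icc 0 T, ‖v k t‖ ≤ V * (m * t) ^ k / k.factorial := by
  induction k with
  | zero =>
    intro t ht
    simpa using h0 t ht
  | succ k ih =>
    intro t ht
    rw [hv k t ht, ← integral_mul_pow_div_factorial]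
    refine intervalIntegral.norm_integral_le_of_norm_le ht.1 (ae_of_all _ fun s hs => ?_)
      (Continuous.intervalIntegrable (by fun_prop) _ _)
    have hs' : s ∈ Set.Icc 0 T := ⟨hs.1.le, hs.2.trans ht.2⟩
    exact (hh k s hs').trans (mul_le_mul_of_nonneg_left (ih s hs') hm)

/-- The constant sequence `d, d, …` satisfies the iterated-integral recursion, so `‖d t‖ ≤ V (m t)^k
/ k!` for every `k`. -/
theorem eq_zero_of_eq_integral {T m : ℝ} (hm : 0 ≤ m) {d h : ℝ → E}
    (hd : ContinuousOn d (Set.Icc 0 T)) (hdh : ∀ t ∈ Set.Icc 0 T, d t = ∫ s in (0 : ℝ)..t, h s)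
    (hh : ∀ s ∈ Set.Icc 0 T, ‖h s‖ ≤ m * ‖d s‖) : ∀ t ∈ Set.Icc 0 T, d t = 0 := by
  intro t ht
  obtain ⟨V, hV⟩ := isCompact_Icc.exists_bound_of_continuousOn hd
  have hb := fun k => norm_le_of_eq_iterated_integral (v := fun _ => d) (h := fun _ => h) hm hV
    (fun _ => hdh) (fun _ => hh) k t ht
  have hlim : Tendsto (fun k : ℕ => V * (m * t) ^ k / k.factorial) atTop (𝓝 0) := by
    simpa [mul_div_assoc] using (FloorSemiring.tendsto_pow_div_factorial_atTop (m * t)).const_mul V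
  exact norm_le_zero_iff.1 (ge_of_tendsto' hlim hb)

end IteratedIntegrals

section LinearODE

variable {n : ℕ}

theorem aemeasurable_mulVec {Ω : Type*} [MeasurableSpace Ω] {μ : Measure Ω} {m : ℕ}
    {F : Ω → Matrix (Fin m) (Fin n) ℝ} {z : Ω → Fin n → ℝ} (hF : ∀ i j, Measurable fun t => F t i j)
    (hz : AEMeasurable z μ) : AEMeasurable (fun t => F t *ᵥ z t) μ := by
  refine aemeasurable_pi_lambda _ fun i => ?_
  simp only [Matrix.mulVec, dotProduct]
  refine Finset.aemeasurable_fun_sum _ fun j _ => ?_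
  exact (hF i j).aemeasurable.mul ((measurable_pi_apply j).comp_aemeasurable hz)

/-- The Neumann series solves the linear integral equation `z(t) = ∫_0^t (F z + g)`. -/
theorem exists_hasSum_iterated_integral {T m : ℝ} (hT : 0 ≤ T) (hm : 0 ≤ m)
    {F : ℝ → Matrix (Fin n) (Fin n) ℝ}
    {g : ℝ → Fin n → ℝ} {ζ : ℕ → ℝ → Fin n → ℝ}
    (hFm : ∀ i j, Measurable fun t => F t i j)
    (hF : ∀ s ∈ Set.Icc 0 T, ∀ x, ‖F s *ᵥ x‖ ≤ m * ‖x‖)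
    (hg : IntegrableOn g (Set.Icc 0 T))
    (h0 : ∀ t ∈ Set.Icc 0 T, ζ 0 t = ∫ s in (0 : ℝ)..t, g s)
    (hs : ∀ k, ∀ t ∈ Set.Icc 0 T, ζ (k + 1) t = ∫ s in (0 : ℝ)..t, F s *ᵥ ζ k s) :
    ∃ z : ℝ → Fin n → ℝ, ContinuousOn z (Set.Icc 0 T) ∧
      (∀ t ∈ Set.Icc 0 T, HasSum (fun k => ζ k t) (z t)) ∧
      IntegrableOn (fun s => F s *ᵥ z s) (Set.Icc 0 T) ∧
      ∀ t ∈ Set.Icc 0 T, z t = ∫ s in (0 : ℝ)..t, (F s *ᵥ z s + g s) := by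
  have hFint : ∀ y : ℝ → Fin n → ℝ, ContinuousOn y (Set.Icc 0 T) →
      IntegrableOn (fun s => F s *ᵥ y s) (Set.Icc 0 T) := by
    intro y hy
    obtain ⟨C, hC⟩ := isCompact_Icc.exists_bound_of_continuousOn hy
    refine Integrable.of_bound
      (aemeasurable_mulVec hFm (hy.aemeasurable measurableSet_Icc)).aestronglyMeasurable (m * C) ?_
    filter_upwards [ae_restrict_mem measurableSet_Icc] with s hs
    exact (hF s hs _).trans (mul_le_mul_of_nonneg_left (hC s hs) hm)
  have hprim : ∀ f : ℝ → Fin n → ℝ, IntegrableOn f (Set.Icc 0 T) →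
      ContinuousOn (fun t => ∫ s in (0 : ℝ)..t, f s) (Set.Icc 0 T) := by
    intro f hf
    rw [← Set.uIcc_of_le hT] at hf ⊢
    exact intervalIntegral.continuousOn_primitive_interval hf
  have hζc : ∀ k, ContinuousOn (ζ k) (Set.Icc 0 T) := by
    intro k
    induction k with
    | zero => exact (hprim g hg).congr h0
    | succ k ih => exact (hprim _ (hFint _ ih)).congr (hs k)
  obtain ⟨V, hV⟩ := isCompact_Icc.exists_bound_of_continuousOn (hζc 0)
  have hV0 : 0 ≤ V := (norm_nonneg _).trans (hV 0 ⟨le_rfl, hT⟩)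
  have hb := fun k => norm_le_of_eq_iterated_integral hm hV hs
    (fun k s hs => hF s hs (ζ k s)) k
  have hb' : ∀ k, ∀ t ∈ Set.Icc 0 T, ‖ζ k t‖ ≤ V * ((m * T) ^ k / k.factorial) := by
    intro k t ht
    refine (hb k t ht).trans ?_
    rw [mul_div_assoc]
    have h1 := ht.1
    have h2 := ht.2
    gcongr
  have hsum : Summable fun k : ℕ => V * ((m * T) ^ k / k.factorial) :=
    (Real.summable_pow_div_factorial _).mul_left V
  have hz : ∀ t ∈ Set.Icc 0 T, HasSum (fun k => ζ k t) (∑' k, ζ k t) := fun t ht =>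
    (Summable.of_norm_bounded hsum fun k => hb' k t ht).hasSum
  have hzc : ContinuousOn (fun t => ∑' k, ζ k t) (Set.Icc 0 T) := continuousOn_tsum hζc hsum hb'
  refine ⟨fun t => ∑' k, ζ k t, hzc, hz, hFint _ hzc, fun t ht => ?_⟩
  have hsub : Set.Icc 0 t ⊆ Set.Icc 0 T := Set.Icc_subset_Icc_right ht.2
  have hsubI : Set.uIoc 0 t ⊆ Set.Icc 0 T := by
    rw [Set.uIoc_of_le ht.1]
    exact Set.Ioc_subset_Icc_self.trans hsub
  have hii : ∀ {f : ℝ → Fin n → ℝ}, IntegrableOn f (Set.Icc 0 T) →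
      IntervalIntegrable f volume 0 t := fun hf =>
    intervalIntegrable_iff.2 (hf.mono_set hsubI)
  rw [intervalIntegral.integral_add (hii (hFint _ hzc)) (hii hg), ← h0 t ht]
  -- Termwise integration, dominated by a summable factorial series, yields the series with its
  -- first term removed; that term is the integral of `g`.
  have hstep : HasSum (fun k => ζ (k + 1) t) (∫ s in (0 : ℝ)..t, F s *ᵥ ∑' k, ζ k s) := by
    simp only [fun k => hs k t ht]
    refine intervalIntegral.hasSum_integral_of_dominated_convergence
      (fun k _ => m * (V * ((m * T) ^ k / k.factorial))) (fun k => ?_) (fun k => ?_) ?_ ?_ ?_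
    · exact ((hFint _ (hζc k)).mono_set hsubI).aestronglyMeasurable
    · exact ae_of_all _ fun s hs' => (hF s (hsubI hs') _).trans
        (mul_le_mul_of_nonneg_left (hb' k s (hsubI hs')) hm)
    · exact ae_of_all _ fun s _ => hsum.mul_left m
    · exact intervalIntegrable_const
    · refine ae_of_all _ fun s hs' => ?_
      exact (hz s (hsubI hs')).map (Matrix.mulVecLin (F s)).toAddMonoidHom
        (LinearMap.continuous_of_finiteDimensional (Matrix.mulVecLin (F s)))
  have h3 := (hasSum_nat_add_iff' 1).2 (hz t ht)
  simp only [Finset.range_one, Finset.sum_singleton] at h3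
  rw [hstep.unique h3]
  abel

/-- The sup distance is at most the sum of the coordinate distances, so the total variation sums are
squeezed to zero. -/
theorem absolutelyContinuousOnInterval_pi {a b : ℝ} {x : ℝ → Fin n → ℝ}
    (h : ∀ i, AbsolutelyContinuousOnInterval (fun t => x t i) a b) :
    AbsolutelyContinuousOnInterval x a b := by
  have hsum := tendsto_finsetSum Finset.univ fun i (_ : i ∈ Finset.univ) => h i
  simp only [Finset.sum_const_zero] at hsum
  refine squeeze_zero (fun E => Finset.sum_nonneg fun _ _ => dist_nonneg) (fun E => ?_) hsum
  rw [Finset.sum_comm]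
  refine Finset.sum_le_sum fun k _ => ?_
  refine (dist_pi_le_iff (Finset.sum_nonneg fun _ _ => dist_nonneg)).2 fun i => ?_
  exact Finset.single_le_sum (f := fun i => dist (x (E.2 k).1 i) (x (E.2 k).2 i))
    (fun _ _ => dist_nonneg) (Finset.mem_univ i)

theorem AbsolutelyContinuousOnInterval.fun_sum {ι : Type*} {a b : ℝ} {f : ι → ℝ → ℝ}
    (s : Finset ι) (h : ∀ i ∈ s, AbsolutelyContinuousOnInterval (f i) a b) :
    AbsolutelyContinuousOnInterval (fun t => ∑ i ∈ s, f i t) a b := by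
  classical
  induction s using Finset.induction_on with
  | empty =>
    simp only [Finset.sum_empty]
    exact (contDiff_const.contDiffOn).absolutelyContinuousOnInterval
  | insert i s hi ih =>
    simp only [Finset.sum_insert hi]
    exact (h i (by simp)).fun_add (ih fun j hj => h j (by simp [hj]))

theorem intervalIntegral_apply {f : ℝ → Fin n → ℝ} (hf : Integrable f) (t : ℝ) (i : Fin n) :
    (∫ s in (0 : ℝ)..t, f s) i = ∫ s in (0 : ℝ)..t, f s i :=
  ((ContinuousLinearMap.proj (R := ℝ) (φ := fun _ : Fin n => ℝ) i).intervalIntegral_comp_comm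
    hf.intervalIntegrable).symm

theorem absolutelyContinuousOnInterval_integral_pi {f : ℝ → Fin n → ℝ} (hf : Integrable f)
    (T : ℝ) : AbsolutelyContinuousOnInterval (fun t => ∫ s in (0 : ℝ)..t, f s) 0 T := by
  refine absolutelyContinuousOnInterval_pi fun i => ?_
  simp only [intervalIntegral_apply hf]
  have hfi : Integrable fun t => f t i :=
    (ContinuousLinearMap.proj (R := ℝ) (φ := fun _ : Fin n => ℝ) i).integrable_comp hf
  exact hfi.intervalIntegrable.absolutelyContinuousOnInterval_intervalIntegral Set.left_mem_uIcc

/-- Variation of constants: the trajectory built from the integral in the rotating frame. -/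
theorem absolutelyContinuousOnInterval_exp_mulVec_integral (A : Matrix (Fin n) (Fin n) ℝ)
    {f : ℝ → Fin n → ℝ} (hf : Integrable f) (T : ℝ) :
    AbsolutelyContinuousOnInterval
      (fun t => NormedSpace.exp (t • A) *ᵥ ∫ s in (0 : ℝ)..t, f s) 0 T := by
  have hz := absolutelyContinuousOnInterval_integral_pi hf T
  refine absolutelyContinuousOnInterval_pi fun i => ?_
  simp only [Matrix.mulVec, dotProduct]
  refine AbsolutelyContinuousOnInterval.fun_sum _ fun j _ => AbsolutelyContinuousOnInterval.fun_mul
    ?_ ?_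
  · refine ContDiffOn.absolutelyContinuousOnInterval (ContDiff.contDiffOn ?_)
    have h1 : ∀ t : ℝ, HasDerivAt (fun t : ℝ => NormedSpace.exp (t • A) i j)
        ((NormedSpace.exp (t • A) * A) i j) t := fun t =>
      hasDerivAt_pi.1 (hasDerivAt_pi.1 (hasDerivAt_exp_smul_const A t) i) j
    refine contDiff_one_iff_deriv.2 ⟨fun t => (h1 t).differentiableAt, ?_⟩
    rw [funext fun t => (h1 t).deriv]
    have h2 : Continuous fun t : ℝ => NormedSpace.exp (t • A) * A :=
      (continuous_iff_continuousAt.2 fun t =>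
        (hasDerivAt_exp_smul_const A t).continuousAt).mul continuous_const
    exact (continuous_apply j).comp ((continuous_apply i).comp h2)
  · simp only [intervalIntegral_apply hf]
    have hfi : Integrable fun t => f t j :=
      (ContinuousLinearMap.proj (R := ℝ) (φ := fun _ : Fin n => ℝ) j).integrable_comp hf
    exact hfi.intervalIntegrable.absolutelyContinuousOnInterval_intervalIntegral Set.left_mem_uIcc

theorem ae_hasDerivAt_exp_mulVec_integral (A : Matrix (Fin n) (Fin n) ℝ)
    {f : ℝ → Fin n → ℝ} (hf : Integrable f) :
    ∀ᵐ t : ℝ, HasDerivAt (fun t : ℝ => NormedSpace.exp (t • A) *ᵥ ∫ s in (0 : ℝ)..t, f s)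
      (A *ᵥ (NormedSpace.exp (t • A) *ᵥ ∫ s in (0 : ℝ)..t, f s) +
        NormedSpace.exp (t • A) *ᵥ f t) t := by
  filter_upwards [LocallyIntegrable.ae_hasDerivAt_integral hf.locallyIntegrable] with t ht
  have h1 := hasDerivAt_exp_smul_const' A t
  have h2 := ht 0
  refine hasDerivAt_pi.2 fun i => ?_
  have h3 : HasDerivAt
      (fun t : ℝ => ∑ j, NormedSpace.exp (t • A) i j * (∫ s in (0 : ℝ)..t, f s) j)
      (∑ j, ((A * NormedSpace.exp (t • A)) i j * (∫ s in (0 : ℝ)..t, f s) j +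
        NormedSpace.exp (t • A) i j * f t j)) t := by
    refine HasDerivAt.fun_sum fun j _ => ?_
    exact (hasDerivAt_pi.1 (hasDerivAt_pi.1 h1 i) j).fun_mul (hasDerivAt_pi.1 h2 j)
  rw [Matrix.mulVec_mulVec, Pi.add_apply]
  simp only [Matrix.mulVec, dotProduct]
  rw [← Finset.sum_add_distrib]
  exact h3

/-- An absolutely continuous function whose derivative is controlled by the function itself and
which vanishes at `0` is zero. -/
theorem AbsolutelyContinuousOnInterval.eq_zero_of_hasDerivAt_mulVec {T m : ℝ} (hT : 0 ≤ T)
    (hm : 0 ≤ m) {M : ℝ → Matrix (Fin n) (Fin n) ℝ} (hMm : ∀ i j, Measurable fun t => M t i j)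
    (hM : ∀ s ∈ Set.Icc 0 T, ∀ x, ‖M s *ᵥ x‖ ≤ m * ‖x‖) {d : ℝ → Fin n → ℝ}
    (hd : AbsolutelyContinuousOnInterval d 0 T) (hd0 : d 0 = 0)
    (hder : ∀ᵐ t : ℝ, t ∈ Set.Icc 0 T → HasDerivAt d (M t *ᵥ d t) t) :
    ∀ t ∈ Set.Icc 0 T, d t = 0 := by
  have hdc : ContinuousOn d (Set.Icc 0 T) := by
    have := hd.continuousOn
    rwa [Set.uIcc_of_le hT] at this
  set f : ℝ → Fin n → ℝ := (Set.Icc 0 T).indicator fun s => M s *ᵥ d s with hf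
  have hfi : Integrable f := by
    obtain ⟨C, hC⟩ := isCompact_Icc.exists_bound_of_continuousOn hdc
    rw [hf, integrable_indicator_iff measurableSet_Icc]
    refine Integrable.of_bound
      (aemeasurable_mulVec hMm (hdc.aemeasurable measurableSet_Icc)).aestronglyMeasurable (m * C) ?_
    filter_upwards [ae_restrict_mem measurableSet_Icc] with s hs
    exact (hM s hs _).trans (mul_le_mul_of_nonneg_left (hC s hs) hm)
  -- By Lebesgue differentiation, `d` and the integral of its derivative differ by an absolutely
  -- continuous function with a.e. zero derivative, hence by a constant. Thus `d` solves an integral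
  -- equation.
  have hac := hd.fun_sub (absolutelyContinuousOnInterval_integral_pi hfi T)
  obtain ⟨C, hC⟩ := hac.const_of_ae_hasDerivAt_zero (by
    filter_upwards [hder,
      LocallyIntegrable.ae_hasDerivAt_integral hfi.locallyIntegrable] with t h1 h2 ht
    rw [Set.uIcc_of_le hT] at ht
    have h3 := (h1 ht).fun_sub (h2 0)
    rwa [hf, Set.indicator_of_mem ht, sub_self] at h3)
  rw [Set.uIcc_of_le hT] at hC
  have hC0 : C = 0 := by
    rw [← hC 0 ⟨le_rfl, hT⟩]
    simp [hd0]
  refine eq_zero_of_eq_integral hm hdc (h := f) (fun t ht => ?_) fun s hs => ?_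
  · exact sub_eq_zero.1 ((hC t ht).trans hC0)
  · rw [hf, Set.indicator_of_mem hs]
    exact hM s hs _

end LinearODE

end

/-! ### Volterra terms and their recursion -/

section

open scoped Matrix Matrix.Norms.Operator

theorem measurable_mulVec {Ω : Type*} [MeasurableSpace Ω] {m n : ℕ}
    {F : Ω → Matrix (Fin m) (Fin n) ℝ} {z : Ω → Fin n → ℝ} (hF : ∀ i j, Measurable fun t => F t i j)
    (hz : Measurable z) : Measurable fun t => F t *ᵥ z t := by
  refine measurable_pi_lambda _ fun i => ?_
  simp only [Matrix.mulVec, dotProduct]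
  exact Finset.measurable_fun_sum _ fun j _ => (hF i j).mul ((measurable_pi_apply j).comp hz)

theorem integral_mulVec {Ω : Type*} [MeasurableSpace Ω] {μ : Measure Ω} {m n : ℕ}
    (A : Matrix (Fin m) (Fin n) ℝ) {f : Ω → Fin n → ℝ} (hf : Integrable f μ) :
    ∫ x, A *ᵥ f x ∂μ = A *ᵥ ∫ x, f x ∂μ :=
  (LinearMap.toContinuousLinearMap (Matrix.mulVecLin A)).integral_comp_comm hf

theorem integrable_mulVec {Ω : Type*} [MeasurableSpace Ω] {μ : Measure Ω} {m n : ℕ}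
    (A : Matrix (Fin m) (Fin n) ℝ) {f : Ω → Fin n → ℝ} (hf : Integrable f μ) :
    Integrable (fun x => A *ᵥ f x) μ :=
  (LinearMap.toContinuousLinearMap (Matrix.mulVecLin A)).integrable_comp hf

/-- A left inverse makes integrability of the two integrands equivalent, so without it both
integrals take the default value zero. No integrability has to be checked when `e^{tA_0}` is pulled
out. -/
theorem integral_mulVec_of_mul_eq_one {Ω : Type*} [MeasurableSpace Ω] {μ : Measure Ω} {n : ℕ}
    {A B : Matrix (Fin n) (Fin n) ℝ} (h : B * A = 1) (f : Ω → Fin n → ℝ) :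
    ∫ x, A *ᵥ f x ∂μ = A *ᵥ ∫ x, f x ∂μ := by
  by_cases hf : Integrable f μ
  · exact integral_mulVec A hf
  · have hAf : ¬ Integrable (fun x => A *ᵥ f x) μ := fun hA => hf (by
      have := integrable_mulVec B hA
      simpa only [Matrix.mulVec_mulVec, h, Matrix.one_mulVec] using this)
    rw [integral_undef hf, integral_undef hAf, Matrix.mulVec_zero]

theorem exp_sub_smul {n : ℕ} (A : Matrix (Fin n) (Fin n) ℝ) (t s : ℝ) :
    NormedSpace.exp ((t - s) • A) = NormedSpace.exp (t • A) * NormedSpace.exp ((-s) • A) := by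
  rw [sub_eq_add_neg, add_smul]
  exact Matrix.exp_add_of_commute _ _ (((Commute.refl A).smul_left t).smul_right (-s))

theorem exp_neg_smul_mul_exp_smul {n : ℕ} (A : Matrix (Fin n) (Fin n) ℝ) (t : ℝ) :
    NormedSpace.exp ((-t) • A) * NormedSpace.exp (t • A) = 1 := by
  have h := exp_sub_smul A (-t) (-t)
  rw [sub_self, zero_smul, NormedSpace.exp_zero, neg_neg] at h
  exact h.symm

theorem continuous_exp_smul {n : ℕ} (A : Matrix (Fin n) (Fin n) ℝ) :
    Continuous fun t : ℝ => NormedSpace.exp (t • A) :=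
  continuous_iff_continuousAt.2 fun t => (hasDerivAt_exp_smul_const A t).continuousAt

theorem integral_Ici_comp_sub {E : Type*} [NormedAddCommGroup E] [NormedSpace ℝ E]
    {h : ℝ → E} (h0 : ∀ s < 0, h s = 0) {t : ℝ} (ht : 0 ≤ t) :
    ∫ r in Set.Ici 0, h (t - r) = ∫ s in (0 : ℝ)..t, h s := by
  have h1 := intervalIntegral.integral_comp_sub_left (a := 0) (b := t) h t
  rw [sub_self, sub_zero] at h1
  rw [← h1, intervalIntegral.integral_of_le ht, ← integral_Icc_eq_integral_Ioc]
  refine setIntegral_eq_of_subset_of_forall_sdiff_eq_zero measurableSet_Ici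
    (fun r hr => hr.1) fun r hr => h0 _ ?_
  by_contra hcon
  exact hr.2 ⟨hr.1, by linarith⟩

namespace LPVSystem

variable {np nin : ℕ} (S : LPVSystem np nin)

theorem continuous_kernelProd (k : ℕ) (I : Fin k → Fin np) :
    Continuous fun τ : Fin (k + 1) → ℝ => S.kernelProd k I τ := by
  induction k with
  | zero => exact (continuous_exp_smul (S.A 0)).comp (continuous_apply 0)
  | succ k ih =>
    simp only [kernelProd]
    refine Continuous.mul (Continuous.mul ?_ continuous_const) ?_
    · exact (continuous_exp_smul (S.A 0)).comp ((continuous_apply _).sub (continuous_apply _))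
    · exact (ih fun j => I j.castSucc).comp (by fun_prop)

theorem measurable_kernelProd_apply (k : ℕ) (I : Fin k → Fin np) (i j : Fin S.nx) :
    Measurable fun τ : Fin (k + 1) → ℝ => S.kernelProd k I τ i j :=
  Continuous.measurable <|
    (continuous_apply j).comp ((continuous_apply i).comp (S.continuous_kernelProd k I))

variable (q : ℝ → Fin np → ℝ) (b : ℝ → Fin S.nx → ℝ)

/-- The integrand of the Volterra term with multi-index `I`. -/
noncomputable def volterraIntegrand (k : ℕ) (I : Fin k → Fin np) (t : ℝ) (τ : Fin (k + 1) → ℝ) :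
    Fin S.nx → ℝ :=
  (∏ j, q (t - τ (Fin.last k) + τ j.castSucc) (I j)) •
    (S.kernelProd k I τ *ᵥ b (t - τ (Fin.last k)))

/-- The term of order `k` of the Volterra series of the state. -/
noncomputable def volterraTerm (k : ℕ) (t : ℝ) : Fin S.nx → ℝ :=
  ∑ I : Fin k → Fin np, ∫ τ, S.volterraIntegrand q b k I t τ ∂simplexMeasure k

/-- The part of `A(p)` that depends on the scheduling signal. -/
noncomputable def scheduledPart (t : ℝ) : Matrix (Fin S.nx) (Fin S.nx) ℝ :=
  ∑ i : Fin np, q t i • S.A i.succ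

/-- The last gap `r` is the time elapsed since the last scheduling event. Because `t - (τ_last + r)
= (t - r) - τ_last`, removing it leaves the integrand of one order less at time `t - r`. -/
theorem volterraIntegrand_simplexSnoc (k : ℕ) (I : Fin (k + 1) → Fin np) (t : ℝ)
    (p : (Fin (k + 1) → ℝ) × ℝ) :
    S.volterraIntegrand q b (k + 1) I t (simplexSnoc k p) =
      (q (t - p.2) (I (Fin.last k)) • (NormedSpace.exp (p.2 • S.A 0) * S.A (I (Fin.last k)).succ)) *ᵥ
        S.volterraIntegrand q b k (fun j => I j.castSucc) (t - p.2) p.1 := by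
  have h2 : t - (p.1 (Fin.last k) + p.2) = t - p.2 - p.1 (Fin.last k) := by ring
  simp only [volterraIntegrand, Fin.prod_univ_castSucc, simplexSnoc_last, simplexSnoc_castSucc,
    kernelProd, h2, sub_add_cancel, add_sub_cancel_left]
  rw [Matrix.smul_mulVec, Matrix.mulVec_smul, Matrix.mulVec_mulVec, smul_smul, mul_comm]

variable {q b}

theorem measurable_volterraIntegrand (hq : Measurable q) (hb : Measurable b) (k : ℕ)
    (I : Fin k → Fin np) (t : ℝ) : Measurable (S.volterraIntegrand q b k I t) := by
  unfold volterraIntegrand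
  have h : Measurable fun τ : Fin (k + 1) → ℝ =>
      ∏ j, q (t - τ (Fin.last k) + τ j.castSucc) (I j) :=
    Finset.measurable_fun_prod _ fun j _ =>
      (measurable_pi_apply (I j)).comp (hq.comp (by fun_prop))
  exact h.smul (measurable_mulVec (S.measurable_kernelProd_apply k I)
    (hb.comp (measurable_const.sub (measurable_pi_apply _))))

theorem abs_prod_scheduling_le_one (hq1 : ∀ t i, |q t i| ≤ 1) {k : ℕ} (I : Fin k → Fin np)
    (f : Fin k → ℝ) : |∏ j, q (f j) (I j)| ≤ 1 := by
  rw [Finset.abs_prod]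
  exact Finset.prod_le_one (fun _ _ => abs_nonneg _) fun _ _ => hq1 _ _

/-- Causality: nothing enters before time zero, so the unbounded simplex is effectively cut off at
`t`. -/
theorem volterraIntegrand_eq_zero (hb0 : ∀ t < 0, b t = 0) {k : ℕ} (I : Fin k → Fin np) {t : ℝ}
    {τ : Fin (k + 1) → ℝ} (h : t < τ (Fin.last k)) : S.volterraIntegrand q b k I t τ = 0 := by
  rw [volterraIntegrand, hb0 _ (by linarith), Matrix.mulVec_zero, smul_zero]

theorem ae_mem_infSimplex (k : ℕ) : ∀ᵐ τ ∂simplexMeasure k, τ ∈ infSimplex k :=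
  ae_restrict_mem (measurableSet_infSimplex k)

theorem infSimplex_bounds {k : ℕ} {τ : Fin (k + 1) → ℝ} (h : τ ∈ infSimplex k) (j : Fin (k + 1)) :
    0 ≤ τ j ∧ τ j ≤ τ (Fin.last k) :=
  ⟨h.1.trans (h.2 (Fin.zero_le j)), h.2 (Fin.le_last j)⟩

theorem volterraTerm_of_neg (hb0 : ∀ t < 0, b t = 0) (k : ℕ) {t : ℝ} (ht : t < 0) :
    S.volterraTerm q b k t = 0 := by
  refine Finset.sum_eq_zero fun I _ => integral_eq_zero_of_ae ?_
  filter_upwards [ae_mem_infSimplex k] with τ hτ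
  exact S.volterraIntegrand_eq_zero hb0 I (ht.trans_le (infSimplex_bounds hτ _).1)

theorem integrable_comp_sub_last {E : Type*} [NormedAddCommGroup E] [MeasurableSpace E]
    [BorelSpace E] [SecondCountableTopology E] {g : ℝ → E} (hg : Measurable g)
    (hgi : Integrable g) (hg0 : ∀ t < 0, g t = 0) (k : ℕ) (t : ℝ) :
    Integrable (fun τ : Fin (k + 1) → ℝ => g (t - τ (Fin.last k))) (simplexMeasure k) := by
  refine ⟨(hg.comp (by fun_prop)).aestronglyMeasurable, ?_⟩
  rw [HasFiniteIntegral, lintegral_simplexMeasure_last k (fun s => ‖g (t - s)‖ₑ) (by fun_prop)]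
  refine (setLIntegral_mono' (g := fun s => ‖g (t - s)‖ₑ * ENNReal.ofReal (t ^ k / k.factorial))
    measurableSet_Ici fun s hs => ?_).trans_lt ?_
  · rcases le_or_gt s t with h | h
    · have : (0 : ℝ) ≤ s := hs
      gcongr
    · simp [hg0 (t - s) (by linarith)]
  · refine (setLIntegral_le_lintegral _ _).trans_lt ?_
    rw [lintegral_mul_const _ (by fun_prop)]
    exact ENNReal.mul_lt_top (hgi.comp_sub_left t).2 ENNReal.ofReal_lt_top

theorem integrable_volterraIntegrand (hq : Measurable q) (hq1 : ∀ t i, |q t i| ≤ 1)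
    (hb : Measurable b) (hbi : Integrable b) (hb0 : ∀ t < 0, b t = 0) (k : ℕ)
    (I : Fin k → Fin np) (t : ℝ) :
    Integrable (S.volterraIntegrand q b k I t) (simplexMeasure k) := by
  -- By causality only tuples in the box `[0, t]^{k+1}` contribute, and the kernel product is
  -- bounded there.
  obtain ⟨C, hC⟩ := (isCompact_Icc (a := (0 : Fin (k + 1) → ℝ))
    (b := fun _ => t)).exists_bound_of_continuousOn (S.continuous_kernelProd k I).continuousOn
  refine ((integrable_comp_sub_last hb hbi hb0 k t).norm.const_mul C).mono'
    (S.measurable_volterraIntegrand hq hb k I t).aestronglyMeasurable ?_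
  filter_upwards [ae_mem_infSimplex k] with τ hτ
  rcases le_or_gt (τ (Fin.last k)) t with h | h
  · rw [volterraIntegrand, norm_smul]
    have h1 := abs_prod_scheduling_le_one hq1 I fun j => t - τ (Fin.last k) + τ j.castSucc
    have h2 := hC τ ⟨fun j => (infSimplex_bounds hτ j).1,
      fun j => (infSimplex_bounds hτ j).2.trans h⟩
    calc _ ≤ 1 * (‖S.kernelProd k I τ‖ * ‖b (t - τ (Fin.last k))‖) := by
          gcongr
          · exact h1
          · exact Matrix.linfty_opNorm_mulVec _ _
      _ ≤ _ := by
          rw [one_mul]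
          gcongr
  · rw [S.volterraIntegrand_eq_zero hb0 I h, hb0 _ (by linarith)]
    simp

theorem volterraTerm_zero (hq : Measurable q) (hb : Measurable b) (hb0 : ∀ t < 0, b t = 0) {t : ℝ} (ht : 0 ≤ t) :
    S.volterraTerm q b 0 t =
      NormedSpace.exp (t • S.A 0) *ᵥ ∫ s in (0 : ℝ)..t, NormedSpace.exp ((-s) • S.A 0) *ᵥ b s := by
  have h1 : S.volterraTerm q b 0 t = ∫ r in Set.Ici 0, NormedSpace.exp (r • S.A 0) *ᵥ b (t - r) := by
    rw [volterraTerm, Fintype.sum_unique, ← measurePreserving_simplexZero.map_eq,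
      integral_map (by fun_prop)]
    · simp [volterraIntegrand, kernelProd]
    · exact (S.measurable_volterraIntegrand hq hb 0 _ t).aestronglyMeasurable
  have h2 := integral_Ici_comp_sub (h := fun s => NormedSpace.exp ((t - s) • S.A 0) *ᵥ b s)
    (fun s hs => by simp [hb0 s hs]) ht
  simp only [sub_sub_cancel] at h2
  rw [h1, h2, intervalIntegral.integral_of_le ht, intervalIntegral.integral_of_le ht,
    ← integral_mulVec_of_mul_eq_one (exp_neg_smul_mul_exp_smul (S.A 0) t)]
  simp only [exp_sub_smul, Matrix.mulVec_mulVec]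

/-- This identifies the Volterra terms with Picard iterates: integrating out the last gap and
summing over the last letter gives a convolution with `e^{rA_0}`, rewritten by `s = t - r`. -/
theorem volterraTerm_succ (hq : Measurable q) (hq1 : ∀ t i, |q t i| ≤ 1)
    (hb : Measurable b) (hbi : Integrable b) (hb0 : ∀ t < 0, b t = 0) (k : ℕ) {t : ℝ}
    (ht : 0 ≤ t) :
    S.volterraTerm q b (k + 1) t =
      NormedSpace.exp (t • S.A 0) *ᵥ ∫ s in (0 : ℝ)..t, NormedSpace.exp ((-s) • S.A 0) *ᵥ
        (S.scheduledPart q s *ᵥ S.volterraTerm q b k s) := by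
  have hint := fun I => S.integrable_volterraIntegrand hq hq1 hb hbi hb0 k I
  have hcomp : ∀ I : Fin (k + 1) → Fin np, Integrable
      (fun p => S.volterraIntegrand q b (k + 1) I t (simplexSnoc k p))
      ((simplexMeasure k).prod (volume.restrict (Set.Ici 0))) := fun I =>
    (measurePreserving_simplexSnoc k).integrable_comp_of_integrable
      (S.integrable_volterraIntegrand hq hq1 hb hbi hb0 (k + 1) I t)
  have hinner : ∀ (I : Fin (k + 1) → Fin np) (r : ℝ),
      ∫ τ, S.volterraIntegrand q b (k + 1) I t (simplexSnoc k (τ, r)) ∂simplexMeasure k =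
      (q (t - r) (I (Fin.last k)) • (NormedSpace.exp (r • S.A 0) * S.A (I (Fin.last k)).succ)) *ᵥ
        ∫ τ, S.volterraIntegrand q b k (fun j => I j.castSucc) (t - r) τ ∂simplexMeasure k := by
    intro I r
    simp only [volterraIntegrand_simplexSnoc]
    exact integral_mulVec _ (hint _ _)
  have h1 : S.volterraTerm q b (k + 1) t = ∫ r in Set.Ici 0,
      NormedSpace.exp (r • S.A 0) *ᵥ
        (S.scheduledPart q (t - r) *ᵥ S.volterraTerm q b k (t - r)) := by
    have e1 : S.volterraTerm q b (k + 1) t = ∑ I : Fin (k + 1) → Fin np, ∫ r in Set.Ici 0,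
        ∫ τ, S.volterraIntegrand q b (k + 1) I t (simplexSnoc k (τ, r)) ∂simplexMeasure k := by
      refine Finset.sum_congr rfl fun I _ => ?_
      rw [← integral_prod_symm _ (hcomp I), ← (measurePreserving_simplexSnoc k).map_eq,
        integral_map (measurePreserving_simplexSnoc k).measurable.aemeasurable
          (S.measurable_volterraIntegrand hq hb _ I t).aestronglyMeasurable]
    rw [e1, ← integral_finsetSum _ fun I _ => (hcomp I).integral_prod_right]
    refine integral_congr_ae (ae_of_all _ fun r => ?_)
    simp only [hinner]
    -- A word is its last letter together with its initial part. The letters add up to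
    -- `scheduledPart`, the initial parts to the term of order `k`.
    rw [← (Fin.snocEquiv fun _ : Fin (k + 1) => Fin np).sum_comp, Fintype.sum_prod_type]
    simp only [Fin.snocEquiv_apply, Fin.snoc_last, Fin.snoc_castSucc, scheduledPart, volterraTerm]
    rw [Matrix.sum_mulVec, Matrix.mulVec_sum]
    refine Finset.sum_congr rfl fun i _ => ?_
    rw [Matrix.mulVec_sum, Matrix.mulVec_sum]
    refine Finset.sum_congr rfl fun I _ => ?_
    rw [Matrix.mulVec_mulVec, Matrix.mul_smul]
  have h2 := integral_Ici_comp_sub (h := fun s => NormedSpace.exp ((t - s) • S.A 0) *ᵥ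
    (S.scheduledPart q s *ᵥ S.volterraTerm q b k s))
    (fun s hs => by simp [S.volterraTerm_of_neg hb0 k hs]) ht
  simp only [sub_sub_cancel] at h2
  rw [h1, h2, intervalIntegral.integral_of_le ht, intervalIntegral.integral_of_le ht,
    ← integral_mulVec_of_mul_eq_one (exp_neg_smul_mul_exp_smul (S.A 0) t)]
  simp only [exp_sub_smul, Matrix.mulVec_mulVec, Matrix.mul_assoc]

end LPVSystem

end

/-! ### The Volterra series of state and output -/

section

open scoped Matrix Matrix.Norms.Operator

namespace LPVSystem

variable {np nin : ℕ} (S : LPVSystem np nin)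

theorem affineComb_zero_add_scheduledPart (q : ℝ → Fin np → ℝ) (t : ℝ) :
    affineComb S.A (q t) = S.A 0 + S.scheduledPart q t := rfl

variable {q : ℝ → Fin np → ℝ}

theorem norm_scheduledPart_le (hq1 : ∀ t i, |q t i| ≤ 1) (t : ℝ) :
    ‖S.scheduledPart q t‖ ≤ ∑ i : Fin np, ‖S.A i.succ‖ := by
  refine norm_sum_le_of_le _ fun i _ => ?_
  rw [norm_smul, Real.norm_eq_abs]
  exact mul_le_of_le_one_left (norm_nonneg _) (hq1 t i)

theorem measurable_affineComb_apply {m n : ℕ} (M : Fin (np + 1) → Matrix (Fin m) (Fin n) ℝ)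
    (hq : Measurable q) (i : Fin m) (j : Fin n) : Measurable fun t => affineComb M (q t) i j := by
  simp only [affineComb, Matrix.add_apply, Matrix.sum_apply, Matrix.smul_apply, smul_eq_mul]
  fun_prop

theorem measurable_scheduledPart_apply (hq : Measurable q) (i j : Fin S.nx) :
    Measurable fun t => S.scheduledPart q t i j := by
  simp only [scheduledPart, Matrix.sum_apply, Matrix.smul_apply, smul_eq_mul]
  fun_prop

theorem measurable_exp_smul_apply {n : ℕ} (A : Matrix (Fin n) (Fin n) ℝ) (i j : Fin n) :
    Measurable fun t : ℝ => NormedSpace.exp (t • A) i j :=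
  Continuous.measurable <|
    (continuous_apply j).comp ((continuous_apply i).comp (continuous_exp_smul A))

theorem exists_norm_exp_smul_le {n : ℕ} (A : Matrix (Fin n) (Fin n) ℝ) (T : ℝ) :
    ∃ C, 0 ≤ C ∧ ∀ t ∈ Set.Icc (-T) T, ‖NormedSpace.exp (t • A)‖ ≤ C := by
  obtain ⟨C, hC⟩ := isCompact_Icc.exists_bound_of_continuousOn
    (continuous_exp_smul A).continuousOn (s := Set.Icc (-T) T)
  exact ⟨max C 0, le_max_right _ _, fun t ht => (hC t ht).trans (le_max_left _ _)⟩

theorem exp_smul_mul_exp_neg_smul {n : ℕ} (A : Matrix (Fin n) (Fin n) ℝ) (t : ℝ) :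
    NormedSpace.exp (t • A) * NormedSpace.exp ((-t) • A) = 1 := by
  simpa using exp_neg_smul_mul_exp_smul A (-t)

/-- The Volterra series sums to a state trajectory. -/
theorem exists_isStateTrajectory {T : ℝ} (hT : 0 ≤ T) {u : ℝ → EuclideanSpace ℝ (Fin nin)}
    {p : ℝ → Fin np → ℝ} {b : ℝ → Fin S.nx → ℝ} (hq : Measurable q) (hq1 : ∀ t i, |q t i| ≤ 1)
    (hpq : ∀ t ∈ Set.Icc 0 T, p t = q t) (hb : Measurable b) (hbi : Integrable b)
    (hb0 : ∀ t < 0, b t = 0)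
    (hub : ∀ t ∈ Set.Icc 0 T, affineComb S.B (p t) *ᵥ (u t).ofLp = b t) :
    ∃ x, S.IsStateTrajectory T u p x ∧ HasSum (fun k => S.volterraTerm q b k T) (x T) := by
  obtain ⟨C, hC0, hC⟩ := exists_norm_exp_smul_le (S.A 0) T
  set a := ∑ i : Fin np, ‖S.A i.succ‖ with ha
  have ha0 : 0 ≤ a := Finset.sum_nonneg fun _ _ => norm_nonneg _
  -- In the rotating frame `z = e^{-tA_0} x` the constant part of `A(p)` disappears, and the
  -- Volterra terms become the Neumann series with generator `F` and source `g`.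
  set F : ℝ → Matrix (Fin S.nx) (Fin S.nx) ℝ := fun s =>
    NormedSpace.exp ((-s) • S.A 0) * S.scheduledPart q s * NormedSpace.exp (s • S.A 0) with hF
  set g : ℝ → Fin S.nx → ℝ := fun s => NormedSpace.exp ((-s) • S.A 0) *ᵥ b s with hg
  have hexpm : ∀ i j, Measurable fun s : ℝ => NormedSpace.exp ((-s) • S.A 0) i j := fun i j =>
    (measurable_exp_smul_apply (S.A 0) i j).comp measurable_neg
  have hFm : ∀ i j, Measurable fun t => F t i j := by
    intro i j
    simp only [hF, Matrix.mul_apply]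
    exact Finset.measurable_fun_sum _ fun l _ => (Finset.measurable_fun_sum _ fun l' _ =>
      (hexpm i l').mul (S.measurable_scheduledPart_apply hq l' l)).mul
        (measurable_exp_smul_apply (S.A 0) l j)
  have hFb : ∀ s ∈ Set.Icc 0 T, ∀ x, ‖F s *ᵥ x‖ ≤ (C * a * C) * ‖x‖ := by
    intro s hs x
    refine (Matrix.linfty_opNorm_mulVec _ _).trans ?_
    gcongr
    refine (norm_mul_le _ _).trans ?_
    gcongr
    · refine (norm_mul_le _ _).trans ?_
      gcongr
      · exact hC _ ⟨by linarith [hs.2], by linarith [hs.1]⟩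
      · exact S.norm_scheduledPart_le hq1 s
    · exact hC _ ⟨by linarith [hs.1], hs.2⟩
  have hgi : IntegrableOn g (Set.Icc 0 T) := by
    refine (hbi.integrableOn.norm.const_mul C).mono'
      (measurable_mulVec hexpm hb).aestronglyMeasurable ?_
    filter_upwards [ae_restrict_mem measurableSet_Icc] with s hs
    refine (Matrix.linfty_opNorm_mulVec _ _).trans ?_
    gcongr
    exact hC _ ⟨by linarith [hs.2], by linarith [hs.1]⟩
  obtain ⟨z, -, hzsum, hFz, hz⟩ := exists_hasSum_iterated_integral hT (by positivity) hFm hFb hgi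
    (ζ := fun k t => NormedSpace.exp ((-t) • S.A 0) *ᵥ S.volterraTerm q b k t)
    (fun t ht => by
      rw [S.volterraTerm_zero hq hb hb0 ht.1, Matrix.mulVec_mulVec, exp_neg_smul_mul_exp_smul,
        Matrix.one_mulVec])
    (fun k t ht => by
      rw [S.volterraTerm_succ hq hq1 hb hbi hb0 k ht.1, Matrix.mulVec_mulVec,
        exp_neg_smul_mul_exp_smul, Matrix.one_mulVec]
      refine intervalIntegral.integral_congr fun s _ => ?_
      simp only [hF, Matrix.mulVec_mulVec]
      rw [Matrix.mul_assoc, exp_smul_mul_exp_neg_smul, Matrix.mul_one])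
  -- Extension by zero gives a function integrable on the whole line; its primitive still equals `z`
  -- on `[0, T]`.
  set f : ℝ → Fin S.nx → ℝ := (Set.Icc 0 T).indicator fun s => F s *ᵥ z s + g s with hf
  have hfi : Integrable f := (integrable_indicator_iff measurableSet_Icc).2 (hFz.add hgi)
  have hfz : ∀ t ∈ Set.Icc 0 T, ∫ s in (0 : ℝ)..t, f s = z t := by
    intro t ht
    rw [hz t ht]
    refine intervalIntegral.integral_congr fun s hs => ?_
    rw [Set.uIcc_of_le ht.1] at hs
    have hmem : s ∈ Set.Icc 0 T := ⟨hs.1, hs.2.trans ht.2⟩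
    simp only [hf, Set.indicator_of_mem hmem]
  refine ⟨fun t => NormedSpace.exp (t • S.A 0) *ᵥ ∫ s in (0 : ℝ)..t, f s, ⟨?_, ?_, ?_⟩, ?_⟩
  · exact absolutelyContinuousOnInterval_exp_mulVec_integral (S.A 0) hfi T
  · simp
  · filter_upwards [ae_hasDerivAt_exp_mulVec_integral (S.A 0) hfi] with t h ht
    convert h using 1
    rw [hub t ht, hfz t ht, hf, Set.indicator_of_mem ht, hpq t ht,
      S.affineComb_zero_add_scheduledPart, Matrix.add_mulVec, Matrix.mulVec_add, add_assoc]
    simp only [hF, hg, Matrix.mulVec_mulVec, ← Matrix.mul_assoc, exp_smul_mul_exp_neg_smul,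
      Matrix.one_mul, Matrix.one_mulVec]
  · have hTm : T ∈ Set.Icc 0 T := ⟨hT, le_rfl⟩
    simp only [hfz T hTm]
    have h := (hzsum T hTm).map (Matrix.mulVecLin (NormedSpace.exp (T • S.A 0))).toAddMonoidHom
      (LinearMap.continuous_of_finiteDimensional (Matrix.mulVecLin (NormedSpace.exp (T • S.A 0))))
    simpa only [Function.comp_def, LinearMap.toAddMonoidHom_coe, Matrix.mulVecLin_apply,
      Matrix.mulVec_mulVec, exp_smul_mul_exp_neg_smul, Matrix.one_mulVec] using h

/-- State trajectories are unique on `[0, T]`. -/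
theorem IsStateTrajectory.eq_of_mem_Icc {S : LPVSystem np nin} {T : ℝ} (hT : 0 ≤ T)
    {u : ℝ → EuclideanSpace ℝ (Fin nin)}
    {p : ℝ → Fin np → ℝ} (hq : Measurable q) (hq1 : ∀ t i, |q t i| ≤ 1)
    (hpq : ∀ t ∈ Set.Icc 0 T, p t = q t) {x y : ℝ → Fin S.nx → ℝ}
    (hx : S.IsStateTrajectory T u p x) (hy : S.IsStateTrajectory T u p y) :
    ∀ t ∈ Set.Icc 0 T, x t = y t := by
  have hM : ∀ s ∈ Set.Icc 0 T, ∀ v, ‖affineComb S.A (q s) *ᵥ v‖ ≤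
      (‖S.A 0‖ + ∑ i : Fin np, ‖S.A i.succ‖) * ‖v‖ := by
    intro s _ v
    refine (Matrix.linfty_opNorm_mulVec _ _).trans ?_
    gcongr
    exact (norm_add_le _ _).trans (add_le_add le_rfl (S.norm_scheduledPart_le hq1 s))
  have h := (hx.absolutelyContinuous.fun_sub hy.absolutelyContinuous).eq_zero_of_hasDerivAt_mulVec
    hT (by positivity) (measurable_affineComb_apply S.A hq) hM (by simp [hx.init, hy.init]) (by
      filter_upwards [hx.ode, hy.ode] with t h1 h2 ht
      have h3 := (h1 ht).fun_sub (h2 ht)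
      rwa [add_sub_add_right_eq_sub, ← Matrix.mulVec_sub, hpq t ht] at h3)
  exact fun t ht => sub_eq_zero.1 (h t ht)

/-- The output is read off an arbitrarily chosen trajectory; uniqueness identifies it at `T` with
the one summed by the Volterra series. -/
theorem hasSum_output {T : ℝ} (hT : 0 ≤ T) {u : ℝ → EuclideanSpace ℝ (Fin nin)}
    {p : ℝ → Fin np → ℝ} {b : ℝ → Fin S.nx → ℝ} (hq : Measurable q) (hq1 : ∀ t i, |q t i| ≤ 1)
    (hpq : ∀ t ∈ Set.Icc 0 T, p t = q t) (hb : Measurable b) (hbi : Integrable b)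
    (hb0 : ∀ t < 0, b t = 0)
    (hub : ∀ t ∈ Set.Icc 0 T, affineComb S.B (p t) *ᵥ (u t).ofLp = b t) :
    HasSum (fun k => (affineComb S.C (p T) *ᵥ S.volterraTerm q b k T) 0) (S.output T u p T) := by
  obtain ⟨x, hx, hsum⟩ := S.exists_isStateTrajectory hT hq hq1 hpq hb hbi hb0 hub
  have hex : ∃ x, S.IsStateTrajectory T u p x := ⟨x, hx⟩
  rw [output, dif_pos hex,
    hex.choose_spec.eq_of_mem_Icc hT hq hq1 hpq hx T ⟨hT, le_rfl⟩]
  have h := hsum.map (Matrix.mulVecLin (affineComb S.C (p T))).toAddMonoidHom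
    (LinearMap.continuous_of_finiteDimensional (Matrix.mulVecLin (affineComb S.C (p T))))
  exact Pi.hasSum.1 h 0

end LPVSystem

end

/-! ### The Hilbert space of Volterra kernels and the features -/

section

open scoped Matrix Matrix.Norms.Operator InnerProductSpace

/-- The index set of the Volterra kernels: `(k, i_q, i_r, I)`. -/
def VolterraIndex (np : ℕ) : Type :=
  Σ k : ℕ, Fin (np + 1) × Fin (np + 1) × (Fin k → Fin np)

instance (np : ℕ) : MeasurableSpace (VolterraIndex np) := ⊤

instance (np : ℕ) : DiscreteMeasurableSpace (VolterraIndex np) := ⟨fun _ => trivial⟩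

instance (np : ℕ) : Countable (VolterraIndex np) := by
  unfold VolterraIndex
  infer_instance

/-- Extension of a finite tuple by zero. -/
def extendTuple (k : ℕ) (τ : Fin (k + 1) → ℝ) (m : ℕ) : ℝ :=
  if h : m < k + 1 then τ ⟨m, h⟩ else 0

/-- The initial segment of a sequence. -/
def initialTuple (k : ℕ) (t : ℕ → ℝ) (j : Fin (k + 1)) : ℝ := t j

-- Padding by zeros places simplices of every dimension in the same space `ℕ → ℝ`, so that kernels
-- of all orders form a single function. Restriction to the initial segment loses nothing.
@[simp] theorem initialTuple_extendTuple (k : ℕ) (τ : Fin (k + 1) → ℝ) :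
    initialTuple k (extendTuple k τ) = τ := by
  funext j
  simp only [initialTuple, extendTuple, j.isLt, dif_pos]

theorem measurable_extendTuple (k : ℕ) : Measurable (extendTuple k) := by
  refine measurable_pi_lambda _ fun m => ?_
  unfold extendTuple
  split_ifs
  · exact measurable_pi_apply _
  · exact measurable_const

theorem measurable_initialTuple (k : ℕ) : Measurable (initialTuple k) :=
  measurable_pi_lambda _ fun j => measurable_pi_apply (j : ℕ)

/-- The disjoint union of the simplices, one for each index. -/
abbrev VolterraSpace (np : ℕ) : Type := VolterraIndex np × (ℕ → ℝ)

/-- The inclusion of a simplex in the disjoint union. -/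
def volterraEmbed {np : ℕ} (i : VolterraIndex np) (τ : Fin (i.1 + 1) → ℝ) : VolterraSpace np :=
  (i, extendTuple i.1 τ)

theorem measurable_volterraEmbed {np : ℕ} (i : VolterraIndex np) : Measurable (volterraEmbed i) :=
  measurable_const.prodMk (measurable_extendTuple i.1)

/-- Lebesgue measure on the disjoint union of the simplices. -/
noncomputable def volterraMeasure (np : ℕ) : Measure (VolterraSpace np) :=
  Measure.sum fun i => (simplexMeasure i.1).map (volterraEmbed i)

instance (np : ℕ) : SFinite (volterraMeasure np) := by
  unfold volterraMeasure
  infer_instance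

theorem lintegral_volterraMeasure {np : ℕ} {f : VolterraSpace np → ENNReal} (hf : Measurable f) :
    ∫⁻ x, f x ∂volterraMeasure np =
      ∑' i, ∫⁻ τ, f (volterraEmbed i τ) ∂simplexMeasure i.1 := by
  rw [volterraMeasure, lintegral_sum_measure]
  exact tsum_congr fun i => lintegral_map hf (measurable_volterraEmbed i)

theorem integrable_comp_volterraEmbed {np : ℕ} {f : VolterraSpace np → ℝ} (hf : Measurable f)
    (hi : Integrable f (volterraMeasure np)) (i : VolterraIndex np) :
    Integrable (fun τ => f (volterraEmbed i τ)) (simplexMeasure i.1) :=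
  (integrable_map_measure hf.aestronglyMeasurable (measurable_volterraEmbed i).aemeasurable).1
    (hi.mono_measure (Measure.le_sum _ i))

theorem hasSum_integral_volterraMeasure {np : ℕ} {f : VolterraSpace np → ℝ} (hf : Measurable f)
    (hi : Integrable f (volterraMeasure np)) :
    HasSum (fun i : VolterraIndex np => ∫ τ, f (volterraEmbed i τ) ∂simplexMeasure i.1)
      (∫ x, f x ∂volterraMeasure np) := by
  have h := hasSum_integral_measure hi
  have e : (fun i : VolterraIndex np => ∫ τ, f (volterraEmbed i τ) ∂simplexMeasure i.1) =
      fun i => ∫ x, f x ∂(simplexMeasure i.1).map (volterraEmbed i) :=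
    funext fun i => (integral_map (measurable_volterraEmbed i).aemeasurable
      hf.aestronglyMeasurable).symm
  rw [e]
  exact h

theorem eLpNorm_two_eq {Ω E : Type*} [MeasurableSpace Ω] {μ : Measure Ω} [NormedAddCommGroup E]
    (f : Ω → E) : eLpNorm f 2 μ = (∫⁻ x, ‖f x‖ₑ ^ 2 ∂μ) ^ (1 / 2 : ℝ) := by
  rw [eLpNorm_eq_lintegral_rpow_enorm_toReal (by simp) (by simp)]
  simp

/-- `(1, p_1, …, p_{np})`. -/
def affineWeight {np : ℕ} (p : Fin np → ℝ) : Fin (np + 1) → ℝ := Fin.cons 1 p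

theorem affineComb_eq_sum {np m n : ℕ} (M : Fin (np + 1) → Matrix (Fin m) (Fin n) ℝ)
    (p : Fin np → ℝ) : affineComb M p = ∑ i, affineWeight p i • M i := by
  simp [affineComb, affineWeight, Fin.sum_univ_succ]

theorem abs_affineWeight_le_one {np : ℕ} {p : Fin np → ℝ} (hp : ∀ i, |p i| ≤ 1)
    (i : Fin (np + 1)) : |affineWeight p i| ≤ 1 := by
  refine Fin.cases ?_ (fun j => ?_) i
  · simp [affineWeight]
  · simpa [affineWeight] using hp j

theorem measurable_affineWeight {np : ℕ} {q : ℝ → Fin np → ℝ} (hq : Measurable q)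
    (i : Fin (np + 1)) : Measurable fun t => affineWeight (q t) i := by
  refine Fin.cases ?_ (fun j => ?_) i
  · simp [affineWeight]
  · simp only [affineWeight, Fin.cons_succ]
    exact (measurable_pi_apply j).comp hq

section Features

variable {np nin : ℕ}

/-- The Volterra kernels of a system as one function. -/
noncomputable def LPVSystem.kernelFun (S : LPVSystem np nin) (lam : ℝ) (x : VolterraSpace np) :
    EuclideanSpace ℝ (Fin nin) :=
  WithLp.toLp 2 (S.kernel lam x.1.2.1 x.1.2.2.1 x.1.2.2.2 (initialTuple x.1.1 x.2) 0)

/-- The scalar factor of the feature of a pair of signals. -/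
noncomputable def featureWeight (lam T : ℝ) (q : ℝ → Fin np → ℝ) (i : VolterraIndex np)
    (τ : Fin (i.1 + 1) → ℝ) : ℝ :=
  affineWeight (q T) i.2.1 * affineWeight (q (T - τ (Fin.last i.1))) i.2.2.1 *
    (∏ j, q (T - τ (Fin.last i.1) + τ j.castSucc) (i.2.2.2 j)) *
      Real.exp (-(lam / 2 * τ (Fin.last i.1)))

/-- The feature of a pair of signals. -/
noncomputable def featureFun (lam T : ℝ) (q : ℝ → Fin np → ℝ)
    (v : ℝ → EuclideanSpace ℝ (Fin nin)) (x : VolterraSpace np) : EuclideanSpace ℝ (Fin nin) :=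
  featureWeight lam T q x.1 (initialTuple x.1.1 x.2) •
    v (T - initialTuple x.1.1 x.2 (Fin.last x.1.1))

theorem LPVSystem.continuous_kernel (S : LPVSystem np nin) (lam : ℝ) (iq ir : Fin (np + 1)) {k : ℕ}
    (I : Fin k → Fin np) : Continuous fun τ : Fin (k + 1) → ℝ => S.kernel lam iq ir I τ := by
  unfold LPVSystem.kernel
  have h : Continuous fun τ : Fin (k + 1) → ℝ => Real.exp (lam / 2 * τ (Fin.last k)) := by fun_prop
  refine h.smul ?_
  exact (continuous_const.matrix_mul (S.continuous_kernelProd k I)).matrix_mul continuous_const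

theorem LPVSystem.measurable_kernelFun (S : LPVSystem np nin) (lam : ℝ) :
    Measurable (S.kernelFun lam) := by
  refine measurable_from_prod_countable_right fun i => ?_
  have h : Continuous fun τ : Fin (i.1 + 1) → ℝ =>
      (WithLp.toLp 2 (S.kernel lam i.2.1 i.2.2.1 i.2.2.2 τ 0) : EuclideanSpace ℝ (Fin nin)) :=
    (PiLp.continuous_toLp 2 _).comp ((continuous_apply 0).comp (S.continuous_kernel lam _ _ _))
  exact h.measurable.comp (measurable_initialTuple i.1)

theorem measurable_featureWeight (lam T : ℝ) {q : ℝ → Fin np → ℝ} (hq : Measurable q)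
    (i : VolterraIndex np) : Measurable (featureWeight lam T q i) := by
  unfold featureWeight
  refine Measurable.mul (Measurable.mul (Measurable.mul measurable_const ?_) ?_) (by fun_prop)
  · exact (measurable_affineWeight hq i.2.2.1).comp
      (measurable_const.sub (measurable_pi_apply (Fin.last i.1)))
  · exact Finset.measurable_fun_prod _ fun j _ =>
      (measurable_pi_apply (i.2.2.2 j)).comp (hq.comp (by fun_prop))

theorem measurable_featureFun (lam T : ℝ) {q : ℝ → Fin np → ℝ} (hq : Measurable q)
    {v : ℝ → EuclideanSpace ℝ (Fin nin)} (hv : Measurable v) :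
    Measurable (featureFun lam T q v) := by
  refine measurable_from_prod_countable_right fun i => ?_
  have h : Measurable fun τ : Fin (i.1 + 1) → ℝ =>
      featureWeight lam T q i τ • v (T - τ (Fin.last i.1)) :=
    (measurable_featureWeight lam T hq i).smul
      (hv.comp (measurable_const.sub (measurable_pi_apply _)))
  exact h.comp (measurable_initialTuple i.1)

/-- The measure is the sum of the Lebesgue measures of the simplices, so only a reordering of
nonnegative sums separates the squared `L²` norm from the defining series. -/
theorem LPVSystem.eLpNorm_kernelFun (S : LPVSystem np nin) (lam : ℝ) :
    eLpNorm (S.kernelFun lam) 2 (volterraMeasure np) = S.h2Norm lam := by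
  have hpt : ∀ (i : VolterraIndex np) (τ : Fin (i.1 + 1) → ℝ),
      ‖S.kernelFun lam (volterraEmbed i τ)‖ₑ ^ 2 =
        ENNReal.ofReal (∑ j, (S.kernel lam i.2.1 i.2.2.1 i.2.2.2 τ 0 j) ^ 2) := by
    intro i τ
    rw [← ofReal_norm, ← ENNReal.ofReal_pow (norm_nonneg _),
      EuclideanSpace.real_norm_sq_eq]
    simp [LPVSystem.kernelFun, volterraEmbed]
  rw [eLpNorm_two_eq, lintegral_volterraMeasure ((S.measurable_kernelFun lam).enorm.pow_const 2),
    LPVSystem.h2Norm]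
  congr 1
  simp only [hpt]
  rw [show (∑' i : VolterraIndex np, ∫⁻ τ, ENNReal.ofReal
      (∑ j, (S.kernel lam i.2.1 i.2.2.1 i.2.2.2 τ 0 j) ^ 2) ∂simplexMeasure i.1) =
      ∑' k : ℕ, ∑' x : Fin (np + 1) × Fin (np + 1) × (Fin k → Fin np), ∫⁻ τ, ENNReal.ofReal
        (∑ j, (S.kernel lam x.1 x.2.1 x.2.2 τ 0 j) ^ 2) ∂simplexMeasure k from ENNReal.tsum_sigma' _]
  simp only [tsum_fintype, Fintype.sum_prod_type]
  rw [Summable.tsum_finsetSum fun _ _ => ENNReal.summable]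
  refine Finset.sum_congr rfl fun iq _ => ?_
  rw [Summable.tsum_finsetSum fun _ _ => ENNReal.summable]
  rfl

theorem abs_featureWeight_le (lam T : ℝ) {q : ℝ → Fin np → ℝ} (hq1 : ∀ t i, |q t i| ≤ 1)
    (i : VolterraIndex np) (τ : Fin (i.1 + 1) → ℝ) :
    |featureWeight lam T q i τ| ≤ Real.exp (-(lam / 2 * τ (Fin.last i.1))) := by
  rw [featureWeight, abs_mul, abs_mul, abs_mul, Real.abs_exp]
  refine mul_le_of_le_one_left (Real.exp_pos _).le ?_
  refine mul_le_one₀ (mul_le_one₀ (abs_affineWeight_le_one (hq1 _) _) (abs_nonneg _)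
    (abs_affineWeight_le_one (hq1 _) _)) (abs_nonneg _) ?_
  exact LPVSystem.abs_prod_scheduling_le_one hq1 _ _

theorem tsum_ofReal_pow_div_factorial {a : ℝ} (ha : 0 ≤ a) :
    ∑' k : ℕ, ENNReal.ofReal (a ^ k / k.factorial) = ENNReal.ofReal (Real.exp a) := by
  rw [← ENNReal.ofReal_tsum_of_nonneg (fun k => by positivity) (Real.summable_pow_div_factorial a),
    Real.exp_eq_exp_ℝ, NormedSpace.exp_eq_tsum_div]

/-- All scheduling factors are at most one in modulus, so the squared feature is dominated by a
function of the last coordinate alone. Its density `s^k / k!` and the number of words sum to `e^{np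
s}`, which the weight `e^{-λ s}` absorbs. -/
theorem eLpNorm_featureFun_le {lam : ℝ} (hlam : (np : ℝ) ≤ lam) (T : ℝ) {q : ℝ → Fin np → ℝ}
    (hq : Measurable q) (hq1 : ∀ t i, |q t i| ≤ 1)
    {v : ℝ → EuclideanSpace ℝ (Fin nin)} (hv : Measurable v) :
    eLpNorm (featureFun lam T q v) 2 (volterraMeasure np) ≤ (np + 1) * eLpNorm v 2 volume := by
  set h : ℝ → ENNReal := fun s => ENNReal.ofReal (Real.exp (-(lam * s))) * ‖v (T - s)‖ₑ ^ 2 with hh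
  have hhm : Measurable h := by fun_prop
  have hpt : ∀ (i : VolterraIndex np) (τ : Fin (i.1 + 1) → ℝ),
      ‖featureFun lam T q v (volterraEmbed i τ)‖ₑ ^ 2 ≤ h (τ (Fin.last i.1)) := by
    intro i τ
    have e1 : featureFun lam T q v (volterraEmbed i τ) =
        featureWeight lam T q i τ • v (T - τ (Fin.last i.1)) := by
      simp [featureFun, volterraEmbed]
    rw [e1, enorm_smul, mul_pow, hh]
    dsimp only
    gcongr
    rw [← ofReal_norm, Real.norm_eq_abs, ← ENNReal.ofReal_pow (abs_nonneg _)]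
    refine ENNReal.ofReal_le_ofReal ?_
    refine (pow_le_pow_left₀ (abs_nonneg _) (abs_featureWeight_le lam T hq1 i τ) 2).trans_eq ?_
    rw [← Real.exp_nat_mul]
    congr 1
    push_cast
    ring
  have hle : ∫⁻ x, ‖featureFun lam T q v x‖ₑ ^ 2 ∂volterraMeasure np ≤
      (np + 1) ^ 2 * ∫⁻ s, ‖v s‖ₑ ^ 2 := by
    rw [lintegral_volterraMeasure ((measurable_featureFun lam T hq hv).enorm.pow_const 2)]
    calc ∑' i : VolterraIndex np, ∫⁻ τ, ‖featureFun lam T q v (volterraEmbed i τ)‖ₑ ^ 2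
            ∂simplexMeasure i.1
        ≤ ∑' i : VolterraIndex np, ∫⁻ s in Set.Ici 0,
            h s * ENNReal.ofReal (s ^ i.1 / i.1.factorial) := by
          refine ENNReal.tsum_le_tsum fun i => ?_
          rw [← lintegral_simplexMeasure_last i.1 h hhm]
          exact lintegral_mono (hpt i)
      _ = ∑' k : ℕ, ∑' _ : Fin (np + 1) × Fin (np + 1) × (Fin k → Fin np), ∫⁻ s in Set.Ici 0,
            h s * ENNReal.ofReal (s ^ k / k.factorial) := ENNReal.tsum_sigma' _
      _ = ∑' k : ℕ, ∫⁻ s in Set.Ici 0, (np + 1) ^ 2 * h s *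
            ENNReal.ofReal ((np * s) ^ k / k.factorial) := by
          refine tsum_congr fun k => ?_
          -- There are `(np + 1)² np^k` indices of order `k`: the first factor is the price of `i_q`
          -- and `i_r`, the second turns `s^k` into `(np s)^k`.
          rw [tsum_fintype, Finset.sum_const, Finset.card_univ, nsmul_eq_mul,
            ← lintegral_const_mul _ (by fun_prop)]
          refine lintegral_congr fun s => ?_
          have e2 : ((np : ℝ) * s) ^ k / k.factorial = (np : ℝ) ^ k * (s ^ k / k.factorial) := by
            rw [mul_pow, mul_div_assoc]
          rw [e2, ENNReal.ofReal_mul (by positivity), ENNReal.ofReal_pow (by positivity),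
            ENNReal.ofReal_natCast]
          simp only [Fintype.card_prod, Fintype.card_fin, Fintype.card_pi, Finset.prod_const,
            Finset.card_univ]
          push_cast
          ring
      _ = ∫⁻ s in Set.Ici 0, ∑' k : ℕ, (np + 1) ^ 2 * h s *
            ENNReal.ofReal ((np * s) ^ k / k.factorial) :=
          (lintegral_tsum fun k => by fun_prop).symm
      -- The exponential series leaves the factor `e^{-λ s} e^{np s}`, which is at most one for `s ≥
      -- 0` because `np ≤ λ`.
      _ ≤ ∫⁻ s in Set.Ici 0, (np + 1) ^ 2 * ‖v (T - s)‖ₑ ^ 2 := by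
          refine setLIntegral_mono' measurableSet_Ici fun s hs => ?_
          have hs0 : (0 : ℝ) ≤ s := hs
          rw [ENNReal.tsum_mul_left, tsum_ofReal_pow_div_factorial (by positivity), hh, mul_assoc]
          dsimp only
          gcongr
          rw [mul_right_comm, ← ENNReal.ofReal_mul (Real.exp_pos _).le, ← Real.exp_add]
          refine mul_le_of_le_one_left zero_le ?_
          rw [ENNReal.ofReal_le_one, Real.exp_le_one_iff]
          nlinarith
      _ ≤ ∫⁻ s, (np + 1) ^ 2 * ‖v (T - s)‖ₑ ^ 2 := setLIntegral_le_lintegral _ _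
      _ = (np + 1) ^ 2 * ∫⁻ s, ‖v s‖ₑ ^ 2 := by
          rw [lintegral_const_mul _ (by fun_prop),
            lintegral_sub_left_eq_self (fun s => ‖v s‖ₑ ^ 2) T]
  rw [eLpNorm_two_eq, eLpNorm_two_eq]
  refine (ENNReal.rpow_le_rpow hle (by norm_num)).trans_eq ?_
  rw [ENNReal.mul_rpow_of_nonneg _ _ (by norm_num), ← ENNReal.rpow_natCast, ← ENNReal.rpow_mul]
  norm_num

end Features

end

/-! ### The output as an inner product -/

section

open scoped Matrix Matrix.Norms.Operator InnerProductSpace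

/-- Off the finite exceptional set the function is continuous on a measurable set, and changing
values at countably many points preserves measurability. -/
theorem PiecewiseContinuous.measurable_indicator {E : Type*} [NormedAddCommGroup E]
    [MeasurableSpace E] [BorelSpace E] {T : ℝ} {f : ℝ → E} (h : PiecewiseContinuous T f) :
    Measurable ((Set.Icc 0 T).indicator f) := by
  classical
  obtain ⟨⟨F, hF⟩, -⟩ := h
  set s : Set ℝ := Set.Icc 0 T \ F with hs
  have hc : ContinuousOn f s := fun t ht => (hF t ht.1 ht.2).mono Set.sdiff_subset
  have hm : Measurable (s.piecewise f 0) := hc.measurable_piecewise continuousOn_const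
    (measurableSet_Icc.diff F.measurableSet)
  refine hm.measurable_of_countable_ne (F.countable_toSet.mono fun t ht => ?_)
  by_contra htF
  refine ht ?_
  by_cases hI : t ∈ Set.Icc 0 T
  · rw [Set.piecewise_eq_of_mem s _ _ (show t ∈ s from ⟨hI, htF⟩), Set.indicator_of_mem hI]
  · rw [Set.piecewise_eq_of_notMem s _ _ (fun h => hI h.1), Set.indicator_of_notMem hI]
    rfl

namespace LPVSystem

variable {np nin : ℕ} (S : LPVSystem np nin)

theorem norm_affineComb_le {m n : ℕ} (M : Fin (np + 1) → Matrix (Fin m) (Fin n) ℝ)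
    {p : Fin np → ℝ} (hp : ∀ i, |p i| ≤ 1) :
    ‖affineComb M p‖ ≤ ‖M 0‖ + ∑ i : Fin np, ‖M i.succ‖ := by
  refine (norm_add_le _ _).trans (add_le_add le_rfl (norm_sum_le_of_le _ fun i _ => ?_))
  rw [norm_smul, Real.norm_eq_abs]
  exact mul_le_of_le_one_left (norm_nonneg _) (hp i)

/-- The weights `e^{λτ/2}` and `e^{-λτ/2}` cancel, so the pairing does not depend on `λ`. -/
theorem inner_kernelFun_featureFun (lam T : ℝ) (q : ℝ → Fin np → ℝ)
    (v : ℝ → EuclideanSpace ℝ (Fin nin)) (i : VolterraIndex np) (τ : Fin (i.1 + 1) → ℝ) :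
    ⟪S.kernelFun lam (volterraEmbed i τ), featureFun lam T q v (volterraEmbed i τ)⟫_ℝ =
      affineWeight (q T) i.2.1 * affineWeight (q (T - τ (Fin.last i.1))) i.2.2.1 *
        (∏ j, q (T - τ (Fin.last i.1) + τ j.castSucc) (i.2.2.2 j)) *
        ((S.C i.2.1 * S.kernelProd i.1 i.2.2.2 τ * S.B i.2.2.1) *ᵥ
          (v (T - τ (Fin.last i.1))).ofLp) 0 := by
  have e1 : S.kernelFun lam (volterraEmbed i τ) =
      WithLp.toLp 2 (S.kernel lam i.2.1 i.2.2.1 i.2.2.2 τ 0) := by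
    simp [kernelFun, volterraEmbed]
  have e2 : featureFun lam T q v (volterraEmbed i τ) =
      featureWeight lam T q i τ • v (T - τ (Fin.last i.1)) := by
    simp [featureFun, volterraEmbed]
  rw [e1, e2, inner_smul_right, PiLp.inner_apply]
  simp only [kernel, Matrix.smul_apply, smul_eq_mul, RCLike.inner_apply, conj_trivial,
    Matrix.mulVec, dotProduct, featureWeight]
  rw [Finset.mul_sum, Finset.mul_sum]
  refine Finset.sum_congr rfl fun j _ => ?_
  have e3 := Real.exp_add (-(lam / 2 * τ (Fin.last i.1))) (lam / 2 * τ (Fin.last i.1))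
  rw [neg_add_cancel, Real.exp_zero] at e3
  linear_combination (-(affineWeight (q T) i.2.1 * affineWeight (q (T - τ (Fin.last i.1))) i.2.2.1 *
    (∏ j, q (T - τ (Fin.last i.1) + τ j.castSucc) (i.2.2.2 j)) *
    (S.C i.2.1 * S.kernelProd i.1 i.2.2.2 τ * S.B i.2.2.1) 0 j *
      (v (T - τ (Fin.last i.1))).ofLp j)) * e3

/-- The affine weights in the feature reassemble `C(p(T))` from the `C_{i_q}`, and the matrix `B` at
the input time from the `B_{i_r}`. -/
theorem sum_inner_kernelFun_featureFun (lam T : ℝ) (q : ℝ → Fin np → ℝ)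
    (v : ℝ → EuclideanSpace ℝ (Fin nin)) (k : ℕ) (I : Fin k → Fin np) (τ : Fin (k + 1) → ℝ) :
    ∑ iq, ∑ ir, ⟪S.kernelFun lam (volterraEmbed ⟨k, iq, ir, I⟩ τ),
        featureFun lam T q v (volterraEmbed ⟨k, iq, ir, I⟩ τ)⟫_ℝ =
      (affineComb S.C (q T) *ᵥ S.volterraIntegrand q
        (fun t => affineComb S.B (q t) *ᵥ (v t).ofLp) k I T τ) 0 := by
  simp only [fun iq ir => S.inner_kernelFun_featureFun lam T q v ⟨k, iq, ir, I⟩ τ]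
  rw [volterraIntegrand, Matrix.mulVec_smul, Matrix.mulVec_mulVec, Matrix.mulVec_mulVec,
    affineComb_eq_sum, affineComb_eq_sum, Matrix.sum_mul, Matrix.sum_mul, Matrix.sum_mulVec,
    Pi.smul_apply, Finset.sum_apply, Finset.smul_sum]
  refine Finset.sum_congr rfl fun iq _ => ?_
  rw [Matrix.mul_sum, Matrix.sum_mulVec, Finset.sum_apply, Finset.smul_sum]
  refine Finset.sum_congr rfl fun ir _ => ?_
  simp only [Matrix.smul_mul, Matrix.mul_smul, Matrix.smul_mulVec, Pi.smul_apply, smul_eq_mul]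
  ring

/-- The output is the pairing of the Volterra kernels with the feature of the signals. -/
theorem output_eq_integral_inner (lam : ℝ) {T : ℝ} (hT : 0 ≤ T)
    {u v : ℝ → EuclideanSpace ℝ (Fin nin)} {p q : ℝ → Fin np → ℝ} (hq : Measurable q)
    (hq1 : ∀ t i, |q t i| ≤ 1) (hpq : ∀ t ∈ Set.Icc 0 T, p t = q t) (hv : Measurable v)
    (hvi : Integrable v) (hv0 : ∀ t < 0, v t = 0) (huv : ∀ t ∈ Set.Icc 0 T, u t = v t)
    (hint : Integrable (fun x => ⟪S.kernelFun lam x, featureFun lam T q v x⟫_ℝ)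
      (volterraMeasure np)) :
    S.output T u p T =
      ∫ x, ⟪S.kernelFun lam x, featureFun lam T q v x⟫_ℝ ∂volterraMeasure np := by
  set b : ℝ → Fin S.nx → ℝ := fun t => affineComb S.B (q t) *ᵥ (v t).ofLp with hb
  have hvm : Measurable fun t => (v t).ofLp := (PiLp.continuous_ofLp 2 _).measurable.comp hv
  have hbm : Measurable b := measurable_mulVec (measurable_affineComb_apply S.B hq) hvm
  have hvi' : Integrable fun t => (v t).ofLp :=
    (EuclideanSpace.equiv (Fin nin) ℝ).toContinuousLinearMap.integrable_comp hvi
  have hbi : Integrable b := by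
    refine (hvi'.norm.const_mul (‖S.B 0‖ + ∑ i : Fin np, ‖S.B i.succ‖)).mono'
      hbm.aestronglyMeasurable (ae_of_all _ fun t => ?_)
    refine (Matrix.linfty_opNorm_mulVec _ _).trans ?_
    gcongr
    exact norm_affineComb_le S.B (hq1 t)
  have hb0 : ∀ t < 0, b t = 0 := fun t ht => by simp [hb, hv0 t ht]
  have hout := S.hasSum_output hT hq hq1 hpq hbm hbi hb0 (u := u)
    (fun t ht => by rw [hpq t ht, huv t ht])
  have hm : Measurable fun x => ⟪S.kernelFun lam x, featureFun lam T q v x⟫_ℝ :=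
    (S.measurable_kernelFun lam).inner (measurable_featureFun lam T hq hv)
  have hsum := hasSum_integral_volterraMeasure hm hint
  have hk : ∀ k : ℕ, HasSum (fun c : Fin (np + 1) × Fin (np + 1) × (Fin k → Fin np) =>
      ∫ τ, ⟪S.kernelFun lam (volterraEmbed ⟨k, c⟩ τ), featureFun lam T q v
        (volterraEmbed ⟨k, c⟩ τ)⟫_ℝ ∂simplexMeasure k)
      ((affineComb S.C (p T) *ᵥ S.volterraTerm q b k T) 0) := by
    intro k
    have hi := fun c : Fin (np + 1) × Fin (np + 1) × (Fin k → Fin np) =>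
      integrable_comp_volterraEmbed hm hint (⟨k, c⟩ : VolterraIndex np)
    suffices h : (affineComb S.C (p T) *ᵥ S.volterraTerm q b k T) 0 =
        ∑ c : Fin (np + 1) × Fin (np + 1) × (Fin k → Fin np),
          ∫ τ, ⟪S.kernelFun lam (volterraEmbed ⟨k, c⟩ τ), featureFun lam T q v
            (volterraEmbed ⟨k, c⟩ τ)⟫_ℝ ∂simplexMeasure k by
      rw [h]
      exact hasSum_fintype _
    rw [hpq T ⟨hT, le_rfl⟩, volterraTerm, Matrix.mulVec_sum, Finset.sum_apply]
    simp only [Fintype.sum_prod_type]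
    rw [Finset.sum_congr rfl fun iq _ => Finset.sum_comm, Finset.sum_comm]
    refine Finset.sum_congr rfl fun I _ => ?_
    have hvI := S.integrable_volterraIntegrand hq hq1 hbm hbi hb0 k I T
    have heval : (∫ τ, affineComb S.C (q T) *ᵥ S.volterraIntegrand q b k I T τ
        ∂simplexMeasure k) 0 = ∫ τ, (affineComb S.C (q T) *ᵥ S.volterraIntegrand q b k I T τ) 0
        ∂simplexMeasure k :=
      eval_integral (fun i =>
        (ContinuousLinearMap.proj (R := ℝ) (φ := fun _ : Fin 1 => ℝ) i).integrable_comp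
          (integrable_mulVec (affineComb S.C (q T)) hvI)) 0
    rw [← integral_mulVec _ hvI, heval]
    simp only [hb, ← S.sum_inner_kernelFun_featureFun lam]
    rw [integral_finsetSum _ fun iq _ => integrable_finsetSum _ fun ir _ => hi (iq, ir, I)]
    exact Finset.sum_congr rfl fun iq _ => integral_finsetSum _ fun ir _ => hi (iq, ir, I)
  -- The integral is a sum over all indices; grouping it by order gives the same terms as the
  -- Volterra series of the output, and sums are unique.
  exact hout.unique (HasSum.sigma hsum hk)

end LPVSystem

end

/-! ### Constants and the risk bound -/

section Final
open scoped InnerProductSpace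

theorem MeasureTheory.MemLp.integrable_of_indicator {E : Type*} [NormedAddCommGroup E] {T : ℝ}
    {f : ℝ → E} (h : MemLp ((Set.Icc 0 T).indicator f) 2 volume) :
    Integrable ((Set.Icc 0 T).indicator f) := by
  rw [integrable_indicator_iff measurableSet_Icc]
  rw [memLp_indicator_iff_restrict measurableSet_Icc] at h
  exact h.integrable (by norm_num)

/-- The slack is `c ≤ 2c`, `2 ≤ 5` and `log(1/δ) ≤ log(8/δ)`. -/
theorem riskRadius_ge {c δ : ℝ} (hc : 0 ≤ c) (hδ : δ ∈ Set.Ioo (0 : ℝ) 1) :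
    c + 2 * c * √(2 * Real.log (1 / δ)) ≤ riskRadius c δ := by
  have h : √(2 * Real.log (1 / δ)) ≤ √(2 * Real.log (8 / δ)) := by
    have := hδ.1
    gcongr
    norm_num
  have h0 := Real.sqrt_nonneg (2 * Real.log (8 / δ))
  unfold riskRadius
  nlinarith [mul_le_mul_of_nonneg_left h hc, mul_nonneg hc h0]

end Final

theorem mainTheorem5
    {np nin : ℕ} (hnp : 0 < np)
    (T : ℝ) (hT : 0 < T)
    -- the class of models and the sets of signals
    (ℰ : Set (LPVSystem np nin))
    (Us : Set (ℝ → EuclideanSpace ℝ (Fin nin))) (Ps : Set (ℝ → Fin np → ℝ)) (Ys : Set (ℝ → ℝ))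
    (hU : ∀ u ∈ Us, PiecewiseContinuous T u)
    (hP : ∀ p ∈ Ps, PiecewiseContinuous T p)
    (hPrange : ∀ p ∈ Ps, ∀ t ∈ Set.Icc 0 T, ∀ i, p t i ∈ Set.Icc (-1 : ℝ) 1)
    (hY : ∀ y ∈ Ys, PiecewiseContinuous T y)
    -- the loss function
    (loss : ℝ → ℝ → ℝ) (K : ℝ)
    (hloss_nonneg : ∀ a b, 0 ≤ loss a b)
    (hloss_lip : ∀ a a' b b' : ℝ, |loss a a' - loss b b'| ≤ K * (|a - b| + |a' - b'|))
    (hloss_diag : ∀ a, loss a a = 0)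
    -- the data distribution, on any σ-algebra for which the losses are random variables
    [MeasurableSpace (DataPoint Us Ps Ys)]
    (D : Measure (DataPoint Us Ps Ys)) [IsProbabilityMeasure D]
    (hmeas : ∀ S ∈ ℰ, Measurable (fun z : DataPoint Us Ps Ys => pointLoss T loss S z))
    -- stability
    (lam : ℝ) (hlam : (np : ℝ) ≤ lam)
    (hstab : ∀ S ∈ ℰ, S.IsQuadStable lam)
    -- bounded `H_2` norm
    (cE : ℝ) (hcE : 0 ≤ cE)
    (hH2 : ∀ S ∈ ℰ, S.h2Norm lam ≤ ENNReal.ofReal cE)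
    -- bounded signals
    (Lu : ℝ) (hLu : 0 ≤ Lu)
    (hu : ∀ u ∈ Us, eLpNorm u 2 (volume.restrict (Set.Icc 0 T)) ≤ ENNReal.ofReal Lu)
    (cy : ℝ) (hy : ∀ y ∈ Ys, |y T| ≤ cy)
    -- sample size and confidence level
    (N : ℕ) (hN : 0 < N) (δ : ℝ) (hδ : δ ∈ Set.Ioo (0 : ℝ) 1)
    -- a minimizer of the true risk
    (Sstar : LPVSystem np nin) (hSstar : Sstar ∈ ℰ)
    (hSstar_min : IsMinOn (trueRisk D T loss) ℰ Sstar) :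
    -- with probability at least `1 - δ`, every minimizer of the empirical risk satisfies the bound
    ∃ G : Set (Fin N → DataPoint Us Ps Ys), MeasurableSet G ∧
      1 - δ ≤ (Measure.pi (fun _ : Fin N => D)).real G ∧
      ∀ s ∈ G, ∀ Shat ∈ ℰ, IsMinOn (empRisk s T loss) ℰ Shat →
        trueRisk D T loss Shat ≤
          trueRisk D T loss Sstar
            + riskRadius (riskConst np K Lu cE cy) δ / Real.sqrt N := by
  have hK : 0 ≤ K := by
    have h := (abs_nonneg _).trans (hloss_lip 1 0 0 0)
    simpa using h
  -- Signals are cut to zero outside `[0, T]`, which makes them measurable on the whole line, keeps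
  -- the scheduling bound, and gives the causality used by the Volterra terms.
  set q : DataPoint Us Ps Ys → ℝ → Fin np → ℝ := fun z => (Set.Icc 0 T).indicator z.p.1 with hq
  set v : DataPoint Us Ps Ys → ℝ → EuclideanSpace ℝ (Fin nin) :=
    fun z => (Set.Icc 0 T).indicator z.u.1 with hv
  have hqm : ∀ z, Measurable (q z) := fun z => (hP _ z.p.2).measurable_indicator
  have hvm : ∀ z, Measurable (v z) := fun z => (hU _ z.u.2).measurable_indicator
  have hq1 : ∀ z t i, |q z t i| ≤ 1 := by
    intro z t i
    by_cases ht : t ∈ Set.Icc 0 T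
    · simp only [hq, Set.indicator_of_mem ht]
      exact abs_le.2 (hPrange _ z.p.2 t ht i)
    · simp [hq, Set.indicator_of_notMem ht]
  have hvn : ∀ z, eLpNorm (v z) 2 volume ≤ ENNReal.ofReal Lu := fun z => by
    rw [hv, eLpNorm_indicator_eq_eLpNorm_restrict measurableSet_Icc]
    exact hu _ z.u.2
  have hvL : ∀ z, MemLp (v z) 2 volume := fun z =>
    ⟨(hvm z).aestronglyMeasurable, (hvn z).trans_lt ENNReal.ofReal_lt_top⟩
  have hΦn : ∀ z, eLpNorm (featureFun lam T (q z) (v z)) 2 (volterraMeasure np) ≤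
      ENNReal.ofReal (((np : ℝ) + 1) * Lu) := fun z => by
    refine (eLpNorm_featureFun_le hlam T (hqm z) (hq1 z) (hvm z)).trans ?_
    rw [ENNReal.ofReal_mul (by positivity), ENNReal.ofReal_add (by positivity) zero_le_one,
      ENNReal.ofReal_natCast, ENNReal.ofReal_one]
    gcongr
    exact hvn z
  have hΦL : ∀ z, MemLp (featureFun lam T (q z) (v z)) 2 (volterraMeasure np) := fun z =>
    ⟨(measurable_featureFun lam T (hqm z) (hvm z)).aestronglyMeasurable,
      (hΦn z).trans_lt ENNReal.ofReal_lt_top⟩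
  have hWn : ∀ S : ℰ, eLpNorm (S.1.kernelFun lam) 2 (volterraMeasure np) ≤ ENNReal.ofReal cE :=
    fun S => by
      rw [LPVSystem.eLpNorm_kernelFun]
      exact hH2 _ S.2
  have hWL : ∀ S : ℰ, MemLp (S.1.kernelFun lam) 2 (volterraMeasure np) := fun S =>
    ⟨(S.1.measurable_kernelFun lam).aestronglyMeasurable,
      (hWn S).trans_lt ENNReal.ofReal_lt_top⟩
  set w : ℰ → Lp (EuclideanSpace ℝ (Fin nin)) 2 (volterraMeasure np) :=
    fun S => (hWL S).toLp _ with hw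
  set φ : DataPoint Us Ps Ys → Lp (EuclideanSpace ℝ (Fin nin)) 2 (volterraMeasure np) :=
    fun z => (hΦL z).toLp _ with hφ
  have hwn : ∀ S, ‖w S‖ ≤ cE := fun S => by
    rw [hw, Lp.norm_toLp]
    exact ENNReal.toReal_le_of_le_ofReal hcE (hWn S)
  have hφn : ∀ z, ‖φ z‖ ≤ ((np : ℝ) + 1) * Lu := fun z => by
    rw [hφ, Lp.norm_toLp]
    exact ENNReal.toReal_le_of_le_ofReal (by positivity) (hΦn z)
  have hout : ∀ (S : ℰ) z, S.1.output T z.u.1 z.p.1 T = inner ℝ (w S) (φ z) := by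
    intro S z
    have hae : (fun x => inner ℝ (w S x) (φ z x)) =ᵐ[volterraMeasure np]
        fun x => inner ℝ (S.1.kernelFun lam x) (featureFun lam T (q z) (v z) x) := by
      filter_upwards [(hWL S).coeFn_toLp, (hΦL z).coeFn_toLp] with x h1 h2
      rw [hw, hφ, h1, h2]
    have hint := (L2.integrable_inner (𝕜 := ℝ) (w S) (φ z)).congr hae
    rw [L2.inner_def, integral_congr_ae hae]
    exact S.1.output_eq_integral_inner lam hT.le (hqm z) (hq1 z)
      (fun t ht => by simp only [hq, Set.indicator_of_mem ht]) (hvm z)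
      (hvL z).integrable_of_indicator
      (fun t ht => Set.indicator_of_notMem (fun h => not_le.2 ht h.1) _)
      (fun t ht => by simp only [hv, Set.indicator_of_mem ht]) hint
  set c := riskConst np K Lu cE cy with hc
  have hc1 : 2 * K * cE * (((np : ℝ) + 1) * Lu) ≤ c := by
    have h := mul_le_mul_of_nonneg_left (le_max_left (Lu * ((np : ℝ) + 1) * cE) cy)
      (mul_nonneg zero_le_two hK)
    rw [hc, riskConst]
    linarith
  have hc0 : 0 ≤ c := le_trans (by positivity) hc1
  -- Comparison with `loss y y = 0` bounds the loss by `K |output - y|`, and Cauchy–Schwarz bounds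
  -- the output by `L_u (np + 1) c_E`. Hence the same `c` serves as loss bound and as bound for `2 K
  -- a b`.
  have hlossc : ∀ (S : ℰ) (z : DataPoint Us Ps Ys), pointLoss T loss S.1 z ≤ c := by
    intro S z
    have h1 := (le_abs_self _).trans (hloss_lip (S.1.output T z.u.1 z.p.1 T) (z.y.1 T)
      (z.y.1 T) (z.y.1 T))
    rw [hloss_diag, sub_zero, sub_self, abs_zero, add_zero] at h1
    have h2 : |S.1.output T z.u.1 z.p.1 T| ≤ Lu * ((np : ℝ) + 1) * cE := by
      rw [hout]
      refine (abs_real_inner_le_norm _ _).trans ?_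
      refine (mul_le_mul (hwn S) (hφn z) (norm_nonneg _) hcE).trans_eq ?_
      ring
    have h3 := hy _ z.y.2
    have h4 : |S.1.output T z.u.1 z.p.1 T - z.y.1 T| ≤ 2 * max (Lu * ((np : ℝ) + 1) * cE) cy := by
      refine (abs_sub _ _).trans ?_
      linarith [le_max_left (Lu * ((np : ℝ) + 1) * cE) cy,
        le_max_right (Lu * ((np : ℝ) + 1) * cE) cy]
    rw [hc, riskConst]
    unfold pointLoss
    linarith [mul_le_mul_of_nonneg_left h4 hK]
  -- Finiteness of the exponent is what the separability instance of `L²` asks for; the dense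
  -- sequence of kernels rests on it.
  have : Fact ((2 : ENNReal) ≠ ⊤) := ⟨ENNReal.ofNat_ne_top⟩
  obtain ⟨G, hG, hGδ, hGs⟩ := exists_measurableSet_risk_le D (w := w) (φ := φ)
    (f := fun S z => pointLoss T loss S.1 z) hwn hφn hK (fun S => hmeas _ S.2)
    (fun S z => hloss_nonneg _ _) hlossc (fun S S' z => by
      rw [← hout, ← hout]
      simpa [pointLoss] using hloss_lip (S.1.output T z.u.1 z.p.1 T) (z.y.1 T)
        (S'.1.output T z.u.1 z.p.1 T) (z.y.1 T)) hN hδ ⟨Sstar, hSstar⟩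
  refine ⟨G, hG, hGδ, fun s hs Shat hShat hmin => ?_⟩
  have hNR : (0 : ℝ) < N := by exact_mod_cast hN
  have hle : empRisk s T loss Shat ≤ empRisk s T loss Sstar := hmin hSstar
  have hsum := le_of_mul_le_mul_left hle (by positivity : (0 : ℝ) < 1 / N)
  refine (hGs s hs ⟨Shat, hShat⟩ hsum).trans ?_
  unfold trueRisk
  gcongr
  exact (add_le_add hc1 le_rfl).trans (riskRadius_ge hc0 hδ)
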